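/- Let $n\ge 1$ and equip $\mathbb{C}^n$ with the symplectic form $\omega=\frac{1}{2i}\sum_k dz_k\wedge d\bar z_k$. For $\Omega\subset\mathbb{R}^n_{\ge 0}$ let $X_\Omega=\{z\in\mathbb{C}^n : (\pi|z_1|^2,\dots,\pi|z_n|^2)\in\Omega\}$ be the associated toric domain. For $r>0$ let $B(r)=X_{b(r)}$ and $Z(r)=X_{z(r)}$ with $b(r)=\{x\in\mathbb{R}^n_{\ge0} : \sum_k x_k<r\}$ and $z(r)=\{x\in\mathbb{R}^n_{\ge0} : x_n<r\}$. The toric domain $X_\Omega$ is called monotone if near every point $\mu\in\partial\Omega\cap\mathbb{R}^n_{>0}$ the set $\Omega$ has a $C^1$ boundary (that is, $\{f<0\}\subset\Omega\subset\{f\le 0\}$ near $\mu$ for a $C^1$ function $f$ with $f(\mu)=0$ and $\nabla f(\mu)\ne 0$) and the outward normals $\nabla f(\mu)$ have nonnegative entries. A symplectic capacity assigns to each symplectic manifold $(M,\omega)$ of dimension $2n$ (or to each member of a class of them that is closed under rescaling the form by positive constants) a number $c(M,\omega)\in[0,\infty]$ such that $c(M_1,\omega_1)\le c(M_2,\omega_2)$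 whenever $(M_1,\omega_1)$ embeds symplectically into $(M_2,\omega_2)$, and $c(M,\alpha\omega)=\alpha\,c(M,\omega)$ for $\alpha>0$. Likewise, a symplectic capacity on a class of subsets of $\mathbb{C}^n$ that is closed under dilations satisfies $c(X)\le c(Y)$ whenever a symplectic embedding into $\mathbb{C}^n$ of an open neighbourhood of $X$ maps $X$ into $Y$, and $c(tX)=t^2c(X)$ for $t>0$. A capacity is normalized if it is defined on $B(1)$ and $Z(1)$ and $c(B(1))=c(Z(1))=1$. Theorem. Let $X_\Omega\subset\mathbb{C}^n$ be a monotone toric domain. (1) If $X_\Omega$ is open, then any two normalized symplectic capacities $c_1,c_2$ of $2n$-dimensional symplectic manifolds that are defined on $(X_\Omega,\omega)$ satisfy $c_1(X_\Omega)=c_2(X_\Omega)$. (2) For arbitrary (open, compact, or other) $X_\Omega$, any two normalized symplectic capacities $c_1,c_2$ of subsets of $\mathbb{C}^n$ that are defined on $X_\Omega$ satisfy $c_1(X_\Omega)=c_2(X_\Omega)$. -/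

import Mathlib

open scoped Manifold ContDiff ENNReal Topology

noncomputable section

namespace SymplecticCapacities

/-- The space `ℂⁿ`, regarded as a real vector space of dimension `2n`. -/
abbrev Cn (n : ℕ) : Type := Fin n → ℂ

/-! ### The standard symplectic form -/

/-- The standard symplectic form `(1 / 2i) ∑ₖ dzₖ ∧ dz̄ₖ` on `ℂⁿ`. On a pair `(u, v)` it takes the
value `(1 / 2i) ∑ₖ (uₖ v̄ₖ - vₖ ūₖ) = ∑ₖ Im (uₖ v̄ₖ)`. -/
def stdForm (n : ℕ) : Cn n [⋀^Fin 2]→L[ℝ] ℝ where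
  toFun v := ∑ k, (v 0 k * starRingEnd ℂ (v 1 k)).im
  map_update_add' := by
    intro inst m i x y
    rw [Subsingleton.elim inst (instDecidableEqFin 2)]
    fin_cases i <;> simp [← Finset.sum_add_distrib] <;>
      exact Finset.sum_congr rfl fun k _ => by ring
  map_update_smul' := by
    intro inst m i c x
    rw [Subsingleton.elim inst (instDecidableEqFin 2)]
    fin_cases i <;> simp [Finset.mul_sum] <;>
      exact Finset.sum_congr rfl fun k _ => by ring
  cont := by fun_prop
  map_eq_zero_of_eq' := by
    intro v i j hij hne
    have h : v 0 = v 1 := by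
      fin_cases i <;> fin_cases j <;> simp_all
    refine Finset.sum_eq_zero fun k _ => ?_
    rw [h, Complex.mul_conj]
    exact Complex.ofReal_im _

lemma stdForm_apply (n : ℕ) (v : Fin 2 → Cn n) :
    stdForm n v = ∑ k, (v 0 k * starRingEnd ℂ (v 1 k)).im := rfl

/-- The expression of `stdForm` in terms of `dz` and `dz̄`. -/
lemma stdForm_eq (n : ℕ) (v : Fin 2 → Cn n) :
    (stdForm n v : ℂ) = 1 / (2 * Complex.I) *
      ∑ k, (v 0 k * starRingEnd ℂ (v 1 k) - v 1 k * starRingEnd ℂ (v 0 k)) := by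
  rw [stdForm_apply, Finset.mul_sum]
  push_cast
  refine Finset.sum_congr rfl fun k _ => ?_
  have h : v 1 k * starRingEnd ℂ (v 0 k) = starRingEnd ℂ (v 0 k * starRingEnd ℂ (v 1 k)) := by
    simp [mul_comm]
  rw [h, Complex.sub_conj]
  field_simp [Complex.I_ne_zero]
  push_cast
  ring

lemma stdForm_nondegenerate (n : ℕ) (u : Cn n) (h : ∀ v, stdForm n ![u, v] = 0) : u = 0 := by
  have h1 := h (fun k => -Complex.I * u k)
  rw [stdForm_apply] at h1
  have h2 : ∀ k, (u k * starRingEnd ℂ (-Complex.I * u k)).im = Complex.normSq (u k) := by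
    intro k
    simp [Complex.normSq_apply]
  simp only [Matrix.cons_val_zero, Matrix.cons_val_one, h2] at h1
  rw [Finset.sum_eq_zero_iff_of_nonneg fun k _ => Complex.normSq_nonneg _] at h1
  funext k
  exact Complex.normSq_eq_zero.1 (h1 k (Finset.mem_univ k))

/-! ### Symplectic manifolds -/

/-- A 2-form on a manifold modelled on `ℂⁿ`: an alternating bilinear form on each tangent space. -/
abbrev TwoForm (n : ℕ) (M : Type) [TopologicalSpace M] [ChartedSpace (Cn n) M] : Type :=
  (x : M) → TangentSpace 𝓘(ℝ, Cn n) x [⋀^Fin 2]→L[ℝ] ℝ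

/-- The expression of a 2-form in the chart `e`: its pullback under `e.symm`. It is meaningful on
`e.target`. -/
def inChart {n : ℕ} {M : Type} [TopologicalSpace M] [ChartedSpace (Cn n) M]
    (η : TwoForm n M) (e : OpenPartialHomeomorph M (Cn n)) (y : Cn n) :
    Cn n [⋀^Fin 2]→L[ℝ] ℝ :=
  (η (e.symm y)).compContinuousLinearMap (mfderiv 𝓘(ℝ, Cn n) 𝓘(ℝ, Cn n) e.symm y)

/-- Symplectic manifolds of dimension `2n`: smooth, Hausdorff, second countable manifolds with a
smooth, closed, nondegenerate 2-form. -/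
structure SymplecticManifold (n : ℕ) where
  carrier : Type
  [top : TopologicalSpace carrier]
  [t2 : T2Space carrier]
  [sc : SecondCountableTopology carrier]
  [charted : ChartedSpace (Cn n) carrier]
  [smooth : IsManifold 𝓘(ℝ, Cn n) ∞ carrier]
  form : TwoForm n carrier
  form_smooth : ∀ e ∈ atlas (Cn n) carrier, ContDiffOn ℝ ∞ (inChart form e) e.target
  form_closed : ∀ e ∈ atlas (Cn n) carrier, ∀ y ∈ e.target, extDeriv (inChart form e) y = 0
  form_nondegenerate : ∀ (x : carrier) (u : TangentSpace 𝓘(ℝ, Cn n) x),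
    (∀ v : TangentSpace 𝓘(ℝ, Cn n) x, form x ![u, v] = 0) → u = 0

attribute [instance] SymplecticManifold.top SymplecticManifold.t2 SymplecticManifold.sc
  SymplecticManifold.charted SymplecticManifold.smooth

/-- Symplectic embeddings of manifolds of the same dimension: smooth topological embeddings that
pull back the one symplectic form to the other. (That the differential is injective follows, as the
form on the source is nondegenerate.) -/
structure IsSymplecticEmbedding {n : ℕ} {M N : SymplecticManifold n}
    (f : M.carrier → N.carrier) : Prop where
  smooth : ContMDiff 𝓘(ℝ, Cn n) 𝓘(ℝ, Cn n) ∞ f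
  isEmbedding : Topology.IsEmbedding f
  pullback : ∀ x : M.carrier,
    (N.form (f x)).compContinuousLinearMap (mfderiv 𝓘(ℝ, Cn n) 𝓘(ℝ, Cn n) f x) = M.form x

lemma inChart_smul {n : ℕ} {M : Type} [TopologicalSpace M] [ChartedSpace (Cn n) M]
    (α : ℝ) (η : TwoForm n M) (e : OpenPartialHomeomorph M (Cn n)) :
    inChart (fun x => α • η x) e = α • inChart η e := rfl

/-- The symplectic manifold `(M, αω)`, for `α ≠ 0`. -/
def SymplecticManifold.scale {n : ℕ} (M : SymplecticManifold n) (α : ℝ) (hα : α ≠ 0) :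
    SymplecticManifold n where
  carrier := M.carrier
  form := fun x => α • M.form x
  form_smooth e he := by
    rw [inChart_smul]
    exact (M.form_smooth e he).const_smul α
  form_closed e he y hy := by
    rw [inChart_smul, extDeriv_smul, M.form_closed e he y hy, smul_zero]
  form_nondegenerate x u h := M.form_nondegenerate x u fun v => by
    have h1 : α * M.form x ![u, v] = 0 := h v
    exact (mul_eq_zero.1 h1).resolve_left hα

/-- The restriction of the standard symplectic form to an open subset of `ℂⁿ`: its pullback under
the inclusion. -/
def restrictedForm (n : ℕ) (U : TopologicalSpace.Opens (Cn n)) : TwoForm n U :=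
  fun x => (stdForm n).compContinuousLinearMap
    (mfderiv 𝓘(ℝ, Cn n) 𝓘(ℝ, Cn n) (Subtype.val : U → Cn n) x)

lemma mfderiv_val_comp_symm (n : ℕ) (U : TopologicalSpace.Opens (Cn n))
    (e : OpenPartialHomeomorph U (Cn n)) (he : e ∈ atlas (Cn n) U) (y : Cn n)
    (hy : y ∈ e.target) (v : Cn n) :
    mfderiv 𝓘(ℝ, Cn n) 𝓘(ℝ, Cn n) (Subtype.val : U → Cn n) (e.symm y)
      (mfderiv 𝓘(ℝ, Cn n) 𝓘(ℝ, Cn n) e.symm y v) = v := by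
  have hs : MDifferentiableAt 𝓘(ℝ, Cn n) 𝓘(ℝ, Cn n) e.symm y :=
    ((contMDiffOn_symm_of_mem_maximalAtlas (I := 𝓘(ℝ, Cn n)) (n := ∞)
      (IsManifold.subset_maximalAtlas he)).contMDiffAt
        (e.open_target.mem_nhds hy)).mdifferentiableAt (by simp)
  have hv : MDifferentiableAt 𝓘(ℝ, Cn n) 𝓘(ℝ, Cn n) (Subtype.val : U → Cn n) (e.symm y) :=
    (contMDiff_subtype_val (n := ∞)).mdifferentiableAt (by simp)
  have hid : (Subtype.val : U → Cn n) ∘ e.symm =ᶠ[𝓝 y] id := by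
    have hne : Nonempty U := ⟨e.symm y⟩
    obtain ⟨x, rfl⟩ := TopologicalSpace.Opens.chart_eq hne he
    refine Filter.eventuallyEq_of_mem (OpenPartialHomeomorph.open_target _ |>.mem_nhds hy)
      fun z hz => ?_
    exact ((chartAt (Cn n) (x : Cn n)).subtypeRestr_symm_eqOn hne hz).symm
  have hd : (mfderiv 𝓘(ℝ, Cn n) 𝓘(ℝ, Cn n) (Subtype.val : U → Cn n) (e.symm y)).comp
      (mfderiv 𝓘(ℝ, Cn n) 𝓘(ℝ, Cn n) e.symm y) =
        ContinuousLinearMap.id ℝ (TangentSpace 𝓘(ℝ, Cn n) y) := by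
    rw [← mfderiv_comp y hv hs, hid.mfderiv_eq, mfderiv_id]
  exact DFunLike.congr_fun hd v

lemma restrictedForm_inChart (n : ℕ) (U : TopologicalSpace.Opens (Cn n))
    (e : OpenPartialHomeomorph U (Cn n)) (he : e ∈ atlas (Cn n) U) (y : Cn n)
    (hy : y ∈ e.target) : inChart (restrictedForm n U) e y = stdForm n := by
  ext v
  exact congrArg (stdForm n) (funext fun i => mfderiv_val_comp_symm n U e he y hy (v i))

/-- An open subset of `ℂⁿ` as a symplectic manifold. -/
def ofOpens (n : ℕ) (U : TopologicalSpace.Opens (Cn n)) : SymplecticManifold n where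
  carrier := U
  form := restrictedForm n U
  form_smooth e he :=
    (contDiffOn_const (c := stdForm n)).congr fun y hy => restrictedForm_inChart n U e he y hy
  form_closed e he y hy := by
    have h : inChart (restrictedForm n U) e =ᶠ[𝓝 y] fun _ => stdForm n :=
      Filter.eventuallyEq_of_mem (e.open_target.mem_nhds hy)
        fun z hz => restrictedForm_inChart n U e he z hz
    rw [h.extDeriv_eq]
    ext v
    rw [extDeriv_apply (differentiableAt_const _)]
    simp
  form_nondegenerate x u h := by
    let A : Cn n →L[ℝ] Cn n := mfderiv 𝓘(ℝ, Cn n) 𝓘(ℝ, Cn n) (Subtype.val : U → Cn n) x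
    have hsurj : Function.Surjective A := fun w => by
      have h1 := mfderiv_val_comp_symm n U (chartAt (Cn n) x) (chart_mem_atlas _ x)
        (chartAt (Cn n) x x) (mem_chart_target _ x) w
      rw [(chartAt (Cn n) x).left_inv (mem_chart_source _ x)] at h1
      exact ⟨_, h1⟩
    have hinj : Function.Injective A :=
      LinearMap.injective_iff_surjective (f := (A : Cn n →ₗ[ℝ] Cn n)) |>.2 hsurj
    have hA : A u = 0 := stdForm_nondegenerate n _ fun w => by
      obtain ⟨v, rfl⟩ := hsurj w
      have h2 : stdForm n (fun i => A ((![u, v] : Fin 2 → Cn n) i)) = 0 := h v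
      convert h2 using 2
      funext i
      fin_cases i <;> rfl
    exact hinj (hA.trans (map_zero A).symm)

/-! ### Toric domains -/

/-- The toric domain `X_Ω`: the preimage of `Ω` under `z ↦ (π|z₁|², …, π|zₙ|²)`. -/
def toricDomain {n : ℕ} (Ω : Set (Fin n → ℝ)) : Set (Cn n) :=
  {z | (fun k => Real.pi * ‖z k‖ ^ 2) ∈ Ω}

/-- The ball `B(r)`. -/
def ball (n : ℕ) (r : ℝ) : Set (Cn n) :=
  toricDomain {x | (∀ k, 0 ≤ x k) ∧ ∑ k, x k < r}

/-- The cylinder `Z(r)`; `⊤ : Fin n` is the index of the last coordinate. -/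
def cylinder (n : ℕ) [NeZero n] (r : ℝ) : Set (Cn n) :=
  toricDomain {x | (∀ k, 0 ≤ x k) ∧ x ⊤ < r}

lemma isOpen_ball (n : ℕ) (r : ℝ) : IsOpen (ball n r) := by
  have h : ball n r = {z | ∑ k, Real.pi * ‖z k‖ ^ 2 < r} := by
    ext z
    simp only [ball, toricDomain, Set.mem_ofPred_eq, and_iff_right_iff_imp]
    intro _ k
    positivity
  rw [h]
  exact isOpen_lt (by fun_prop) continuous_const

lemma isOpen_cylinder (n : ℕ) [NeZero n] (r : ℝ) : IsOpen (cylinder n r) := by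
  have h : cylinder n r = {z | Real.pi * ‖z ⊤‖ ^ 2 < r} := by
    ext z
    simp only [cylinder, toricDomain, Set.mem_ofPred_eq, and_iff_right_iff_imp]
    intro _ k
    positivity
  rw [h]
  exact isOpen_lt (by fun_prop) continuous_const

/-- `v` is an outward normal vector of `Ω` at its boundary point `μ`: near `μ`, the boundary of `Ω`
is a `C¹` hypersurface `{f = 0}` with `{f < 0} ⊆ Ω ⊆ {f ≤ 0}`, and `v` is the gradient of the
defining function `f` at `μ`, which is nonzero. The set `Ω` may contain its boundary points or
not. -/
def IsOutwardNormal {n : ℕ} (Ω : Set (Fin n → ℝ)) (μ v : Fin n → ℝ) : Prop :=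
  v ≠ 0 ∧ ∃ f : (Fin n → ℝ) → ℝ, ContDiffAt ℝ 1 f μ ∧ f μ = 0 ∧
    (∀ w, fderiv ℝ f μ w = ∑ k, v k * w k) ∧
    ∀ᶠ x in 𝓝 μ, (f x < 0 → x ∈ Ω) ∧ (x ∈ Ω → f x ≤ 0)

/-- `Ω ⊆ ℝⁿ_{≥ 0}` defines a monotone toric domain: at every boundary point with positive
coordinates there is an outward normal, and the outward normals there have nonnegative entries. -/
structure IsMonotone {n : ℕ} (Ω : Set (Fin n → ℝ)) : Prop where
  nonneg : ∀ x ∈ Ω, ∀ k, 0 ≤ x k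
  exists_normal : ∀ μ ∈ frontier Ω, (∀ k, 0 < μ k) → ∃ v, IsOutwardNormal Ω μ v
  normal_nonneg : ∀ μ ∈ frontier Ω, (∀ k, 0 < μ k) → ∀ v, IsOutwardNormal Ω μ v → ∀ k, 0 ≤ v k

/-! ### Symplectic capacities -/

/-- A symplectic capacity on a class `dom` of symplectic manifolds of dimension `2n` that is closed
under positive rescaling of the form; `dom` may consist of all of them. The values of `val` outside
`dom` play no role. -/
structure Capacity (n : ℕ) where
  dom : Set (SymplecticManifold n)
  scale_mem : ∀ M ∈ dom, ∀ (α : ℝ) (hα : 0 < α), M.scale α hα.ne' ∈ dom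
  val : SymplecticManifold n → ℝ≥0∞
  monotone : ∀ M ∈ dom, ∀ N ∈ dom,
    (∃ f : M.carrier → N.carrier, IsSymplecticEmbedding f) → val M ≤ val N
  conformal : ∀ M ∈ dom, ∀ (α : ℝ) (hα : 0 < α),
    val (M.scale α hα.ne') = ENNReal.ofReal α * val M

/-- A capacity is normalized if `c(B(1)) = c(Z(1)) = 1`. -/
structure Capacity.IsNormalized {n : ℕ} [NeZero n] (c : Capacity n) : Prop where
  ball_mem : ofOpens n ⟨ball n 1, isOpen_ball n 1⟩ ∈ c.dom
  cylinder_mem : ofOpens n ⟨cylinder n 1, isOpen_cylinder n 1⟩ ∈ c.dom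
  val_ball : c.val (ofOpens n ⟨ball n 1, isOpen_ball n 1⟩) = 1
  val_cylinder : c.val (ofOpens n ⟨cylinder n 1, isOpen_cylinder n 1⟩) = 1

/-- `X ⊆ ℂⁿ` embeds symplectically into `Y ⊆ ℂⁿ`: some symplectic embedding into `ℂⁿ` of an open
neighbourhood of `X` maps `X` into `Y`. -/
def SymplecticallyEmbeds {n : ℕ} (X Y : Set (Cn n)) : Prop :=
  ∃ (U : Set (Cn n)) (f : Cn n → Cn n), IsOpen U ∧ X ⊆ U ∧ ContDiffOn ℝ ∞ f U ∧ Set.InjOn f U ∧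
    (∀ x ∈ U, (stdForm n).compContinuousLinearMap (fderiv ℝ f x) = stdForm n) ∧ Set.MapsTo f X Y

/-- The dilate `tX` of `X ⊆ ℂⁿ`. -/
def dilate {n : ℕ} (t : ℝ) (X : Set (Cn n)) : Set (Cn n) := (fun z => t • z) '' X

/-- A symplectic capacity on a class `dom` of subsets of `ℂⁿ` that is closed under dilations. The
values of `val` outside `dom` play no role. -/
structure SubsetCapacity (n : ℕ) where
  dom : Set (Set (Cn n))
  dilate_mem : ∀ X ∈ dom, ∀ t : ℝ, 0 < t → dilate t X ∈ dom
  val : Set (Cn n) → ℝ≥0∞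
  monotone : ∀ X ∈ dom, ∀ Y ∈ dom, SymplecticallyEmbeds X Y → val X ≤ val Y
  conformal : ∀ X ∈ dom, ∀ t : ℝ, 0 < t → val (dilate t X) = ENNReal.ofReal (t ^ 2) * val X

/-- A capacity is normalized if `c(B(1)) = c(Z(1)) = 1`. -/
structure SubsetCapacity.IsNormalized {n : ℕ} [NeZero n] (c : SubsetCapacity n) : Prop where
  ball_mem : ball n 1 ∈ c.dom
  cylinder_mem : cylinder n 1 ∈ c.dom
  val_ball : c.val (ball n 1) = 1
  val_cylinder : c.val (cylinder n 1) = 1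

end SymplecticCapacities

end

noncomputable section

namespace SymplecticCapacities

open ComplexConjugate

/-! The common value is the supremum of the `R` such that `Ω` contains the open simplex `{x : xₖ >
0, ∑ xₖ < R}`, and `IsPinned` records the two bounds that force it.

Lower bound: if the simplex of size `R` lies in `Ω` and `r < R`, then `B(r)` embeds into `X_Ω`. The
plane embeds, preserving area, into the complement of a ray in such a way that discs of bounded area
grow by arbitrarily little (`exists_slit_embedding`). Applied in each coordinate, this moves `B(r)`
off the coordinate hyperplanes, so only points of `Ω` with positive coordinates matter; monotonicity
is not needed here.

Upper bound: suppose `x ∉ Ω` has positive coordinates and `∑ xₖ < R`. By monotonicity no point of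
`Ω` exceeds `x` in every coordinate (`IsMonotone.mem_of_lt`), so `X_Ω` lies in the union of the
cylinders `{π|zₖ|² ≤ xₖ}`. This whole union embeds into `Z(R)` (`exists_embedding_into_cylinder`).
After slitting, polar coordinates normalized by areas `aₖ` slightly above `xₖ` turn the `k`-th plane
into a half-strip of width `aₖ`, and the union into a set on which the minimum of the real parts is
below `1`. The cotangent lift of a change of variables having a smooth minimum as one coordinate
(`straighten`) makes that minimum a coordinate whose conjugate is the sum of the imaginary parts, of
absolute value below `∑ aₖ / 2`. Inverse polar coordinates for the area `∑ aₖ` then lead into a disc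
of area at most `R`.

All the embeddings are defined on the whole of `ℂⁿ`, so the same maps serve open manifolds and
arbitrary subsets. -/

/-! ### Area preserving maps and symplectic maps -/

/-- `f` is a smooth, injective, area preserving map on `s ⊆ ℂ`. -/
structure AreaPreservingOn (f : ℂ → ℂ) (s : Set ℂ) : Prop where
  contDiffAt : ∀ x ∈ s, ContDiffAt ℝ ∞ f x
  injOn : Set.InjOn f s
  pullback : ∀ x ∈ s, ∃ f' : ℂ →L[ℝ] ℂ, HasFDerivAt f f' x ∧
    ∀ u v, (f' u * conj (f' v)).im = (u * conj v).im

/-- `f` is smooth and injective on `s ⊆ ℂⁿ`, and pulls back the standard form to `α` times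
itself. -/
structure ConformalOn {n : ℕ} (α : ℝ) (f : Cn n → Cn n) (s : Set (Cn n)) : Prop where
  contDiffAt : ∀ x ∈ s, ContDiffAt ℝ ∞ f x
  injOn : Set.InjOn f s
  pullback : ∀ x ∈ s, ∃ f' : Cn n →L[ℝ] Cn n, HasFDerivAt f f' x ∧
    ∀ u v, ∑ k, (f' u k * conj (f' v k)).im = α * ∑ k, (u k * conj (v k)).im

lemma ConformalOn.comp {n : ℕ} {α β : ℝ} {f g : Cn n → Cn n} {s t : Set (Cn n)}
    (hg : ConformalOn β g t) (hf : ConformalOn α f s) (h : Set.MapsTo f s t) :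
    ConformalOn (β * α) (g ∘ f) s where
  contDiffAt x hx := (hg.contDiffAt _ (h hx)).comp x (hf.contDiffAt x hx)
  injOn := hg.injOn.comp hf.injOn h
  pullback x hx := by
    obtain ⟨f', hf', hf2⟩ := hf.pullback x hx
    obtain ⟨g', hg', hg2⟩ := hg.pullback _ (h hx)
    refine ⟨g'.comp f', hg'.comp x hf', fun u v => ?_⟩
    rw [mul_assoc, ← hf2, ← hg2]
    rfl

/-- A product of area preserving maps is symplectic. -/
lemma conformalOn_pi {n : ℕ} {f : Fin n → ℂ → ℂ} {s : Fin n → Set ℂ}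
    (h : ∀ k, AreaPreservingOn (f k) (s k)) :
    ConformalOn 1 (fun z k => f k (z k)) (Set.univ.pi s) where
  contDiffAt x hx := by
    rw [contDiffAt_pi]
    intro k
    exact ((h k).contDiffAt (x k) (hx k trivial)).comp x (by fun_prop)
  injOn x hx y hy hxy := by
    funext k
    exact (h k).injOn (hx k trivial) (hy k trivial) (congrFun hxy k)
  pullback x hx := by
    choose f' hf' hf2 using fun k => (h k).pullback (x k) (hx k trivial)
    refine ⟨ContinuousLinearMap.pi fun k => (f' k).comp (ContinuousLinearMap.proj k), ?_, ?_⟩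
    · rw [hasFDerivAt_pi]
      intro k
      exact (hf' k).comp x (hasFDerivAt_apply k x)
    · intro u v
      rw [one_mul]
      exact Finset.sum_congr rfl fun k _ => hf2 k (u k) (v k)

lemma conformalOn_smul (n : ℕ) {t : ℝ} (ht : t ≠ 0) :
    ConformalOn (t ^ 2) (fun z : Cn n => t • z) Set.univ where
  contDiffAt x _ := by fun_prop
  injOn := (smul_right_injective _ ht).injOn
  pullback x _ := by
    refine ⟨t • ContinuousLinearMap.id ℝ (Cn n), (hasFDerivAt_id x).const_smul t, fun u v => ?_⟩
    rw [Finset.mul_sum]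
    refine Finset.sum_congr rfl fun k _ => ?_
    simp
    ring

/-- A linear map that scales the standard form by a nonzero factor is invertible. -/
lemma exists_equiv_of_conformal {n : ℕ} {α : ℝ} (hα : α ≠ 0) (A : Cn n →L[ℝ] Cn n)
    (hA : ∀ u v, ∑ k, (A u k * conj (A v k)).im = α * ∑ k, (u k * conj (v k)).im) :
    ∃ e : Cn n ≃L[ℝ] Cn n, (e : Cn n →L[ℝ] Cn n) = A := by
  have hinj : Function.Injective (A : Cn n →ₗ[ℝ] Cn n) := by
    rw [injective_iff_map_eq_zero]
    intro u hu
    refine stdForm_nondegenerate n u fun v => ?_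
    have h := hA u v
    have hu' : A u = 0 := hu
    simp only [hu', Pi.zero_apply, zero_mul, Complex.zero_im, Finset.sum_const_zero] at h
    rw [stdForm_apply]
    exact (mul_eq_zero.1 h.symm).resolve_left hα
  exact ⟨(LinearEquiv.ofInjectiveEndo _ hinj).toContinuousLinearEquiv, by ext; rfl⟩

/-- Conformally symplectic injections are topological embeddings. -/
lemma ConformalOn.isOpenEmbedding {n : ℕ} {α : ℝ} (hα : α ≠ 0) {f : Cn n → Cn n}
    (hf : ConformalOn α f Set.univ) : Topology.IsOpenEmbedding f := by
  have hc : ContDiff ℝ ∞ f := contDiff_iff_contDiffAt.2 fun x => hf.contDiffAt x trivial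
  refine .of_continuous_injective_isOpenMap hc.continuous (Set.injOn_univ.1 hf.injOn) ?_
  have h : ∀ x, ∃ e : Cn n ≃L[ℝ] Cn n, HasStrictFDerivAt f (e : Cn n →L[ℝ] Cn n) x := by
    intro x
    obtain ⟨f', hf', h2⟩ := hf.pullback x trivial
    obtain ⟨e, he⟩ := exists_equiv_of_conformal hα f' h2
    exact ⟨e, he ▸ (hf.contDiffAt x trivial).hasStrictFDerivAt' hf' (by simp)⟩
  choose e he using h
  exact isOpenMap_of_hasStrictFDerivAt_equiv he

/-- The inverse of a smooth bijection of `ℂ` with injective differentials is smooth. -/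
lemma contDiff_symm_of_injective {f : ℂ ≃ ℂ} (hf : ContDiff ℝ ∞ f)
    (hf' : ∀ x u, fderiv ℝ f x u = 0 → u = 0) : ContDiff ℝ ∞ f.symm := by
  rw [contDiff_iff_contDiffAt]
  intro y
  obtain ⟨x, rfl⟩ := f.surjective y
  have hinj : Function.Injective (fderiv ℝ f x : ℂ →ₗ[ℝ] ℂ) :=
    (injective_iff_map_eq_zero _).2 fun u hu => hf' x u hu
  let e : ℂ ≃L[ℝ] ℂ := (LinearEquiv.ofInjectiveEndo _ hinj).toContinuousLinearEquiv
  have hd : HasFDerivAt f (e : ℂ →L[ℝ] ℂ) x := by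
    have : (e : ℂ →L[ℝ] ℂ) = fderiv ℝ f x := by ext; rfl
    rw [this]
    exact (hf.differentiable (by simp) x).hasFDerivAt
  have hl := hf.contDiffAt.to_localInverse hd (by simp)
  refine hl.congr_of_eventuallyEq ?_
  have hr := (hf.contDiffAt.hasStrictFDerivAt' hd (by simp)).eventually_right_inverse
  filter_upwards [hr] with z hz
  rw [Equiv.symm_apply_eq]
  exact hz.symm

/-! ### An area preserving embedding of the plane into the slit plane -/

/-- A smooth approximation of the positive part. -/
def softPos (x : ℝ) : ℝ := (x + √(x ^ 2 + 1)) / 2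

/-- The derivative of `softPos`. -/
def softStep (x : ℝ) : ℝ := (1 + x / √(x ^ 2 + 1)) / 2

lemma abs_lt_sqrt_sq_add_one (x : ℝ) : |x| < √(x ^ 2 + 1) := by
  rw [← Real.sqrt_sq_eq_abs]
  exact Real.sqrt_lt_sqrt (sq_nonneg x) (by linarith)

lemma hasDerivAt_softPos (x : ℝ) : HasDerivAt softPos (softStep x) x := by
  have h1 : HasDerivAt (fun x : ℝ => x ^ 2 + 1) (2 * x) x := by
    simpa using (hasDerivAt_pow 2 x).add_const (1 : ℝ)
  have h2 := ((hasDerivAt_id x).add (h1.sqrt (by positivity))).div_const 2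
  have h3 : softStep x = (1 + 2 * x / (2 * √(x ^ 2 + 1))) / 2 := by
    unfold softStep
    field_simp
  rw [h3]
  exact h2

lemma contDiff_softPos : ContDiff ℝ ∞ softPos := by
  unfold softPos
  have : ContDiff ℝ ∞ fun x : ℝ => √(x ^ 2 + 1) :=
    ContDiff.sqrt (by fun_prop) fun x => by positivity
  fun_prop

lemma contDiff_softStep : ContDiff ℝ ∞ softStep := by
  unfold softStep
  have h : ContDiff ℝ ∞ fun x : ℝ => √(x ^ 2 + 1) :=
    ContDiff.sqrt (by fun_prop) fun x => by positivity
  have h2 : ContDiff ℝ ∞ fun x : ℝ => x / √(x ^ 2 + 1) :=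
    contDiff_id.div h fun x => by positivity
  fun_prop

lemma softStep_pos (x : ℝ) : 0 < softStep x := by
  have h := abs_lt_sqrt_sq_add_one x
  have h0 : 0 < √(x ^ 2 + 1) := by positivity
  have h1 : -1 < x / √(x ^ 2 + 1) := by
    rw [lt_div_iff₀ h0]
    linarith [neg_abs_le x]
  unfold softStep
  linarith

lemma softStep_lt_one (x : ℝ) : softStep x < 1 := by
  have h := abs_lt_sqrt_sq_add_one x
  have h0 : 0 < √(x ^ 2 + 1) := by positivity
  have h1 : x / √(x ^ 2 + 1) < 1 := by
    rw [div_lt_iff₀ h0]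
    linarith [le_abs_self x]
  unfold softStep
  linarith

lemma softPos_pos (x : ℝ) : 0 < softPos x := by
  have h := abs_lt_sqrt_sq_add_one x
  unfold softPos
  linarith [neg_abs_le x]

lemma sub_softPos_neg (x : ℝ) : x - softPos x < 0 := by
  have h := abs_lt_sqrt_sq_add_one x
  unfold softPos
  linarith [le_abs_self x]

lemma neg_le_sub_softPos (x : ℝ) : -(|x| + 1) ≤ x - softPos x := by
  have h : √(x ^ 2 + 1) ≤ |x| + 1 := by
    rw [Real.sqrt_le_left (by positivity)]
    nlinarith [sq_abs x, abs_nonneg x]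
  unfold softPos
  linarith [neg_abs_le x]

/-- The bump `1 / (1 + y²)`, which is the derivative of `arctan`. -/
def bump (y : ℝ) : ℝ := 1 / (1 + y ^ 2)

lemma bump_pos (y : ℝ) : 0 < bump y := by unfold bump; positivity

lemma bump_le_one (y : ℝ) : bump y ≤ 1 := by
  unfold bump
  rw [div_le_one (by positivity)]
  nlinarith [sq_nonneg y]

lemma softStep_mul_bump_lt_one (x y : ℝ) : softStep x * bump y < 1 := by
  nlinarith [softStep_lt_one x, softStep_pos x, bump_pos y, bump_le_one y]

lemma contDiff_bump : ContDiff ℝ ∞ bump := by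
  unfold bump
  exact contDiff_const.div (by fun_prop) fun y => by positivity

/-- With `slitTarget`, the two halves of the generating function of `slitEmbedding`. -/
def slitSource (w : ℂ) : ℂ := ⟨w.re, w.im - softStep w.re * Real.arctan w.im⟩

/-- The vertical lines are mapped to curves that avoid the nonnegative real axis. -/
def slitTarget (w : ℂ) : ℂ := ⟨w.re - softPos w.re * bump w.im, w.im⟩

lemma hasFDerivAt_re (w : ℂ) : HasFDerivAt Complex.re Complex.reCLM w :=
  Complex.reCLM.hasFDerivAt

lemma hasFDerivAt_im (w : ℂ) : HasFDerivAt Complex.im Complex.imCLM w :=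
  Complex.imCLM.hasFDerivAt

/-- Differentiability of a complex function from that of its real and imaginary part. -/
lemma hasFDerivAt_mk {E : Type*} [NormedAddCommGroup E] [NormedSpace ℝ E] {a b : E → ℝ}
    {a' b' : E →L[ℝ] ℝ} {x : E} (ha : HasFDerivAt a a' x) (hb : HasFDerivAt b b' x) :
    HasFDerivAt (fun w => (⟨a w, b w⟩ : ℂ))
      (Complex.equivRealProdCLM.symm.toContinuousLinearMap.comp (a'.prod b')) x :=
  Complex.equivRealProdCLM.symm.toContinuousLinearMap.hasFDerivAt.comp x (ha.prodMk hb)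

lemma contDiffAt_mk {E : Type*} [NormedAddCommGroup E] [NormedSpace ℝ E] {a b : E → ℝ}
    {x : E} (ha : ContDiffAt ℝ ∞ a x) (hb : ContDiffAt ℝ ∞ b x) :
    ContDiffAt ℝ ∞ (fun w => (⟨a w, b w⟩ : ℂ)) x :=
  Complex.equivRealProdCLM.symm.contDiff.contDiffAt.comp x (ha.prodMk hb)

lemma contDiff_re : ContDiff ℝ ∞ Complex.re := Complex.reCLM.contDiff

lemma contDiff_im : ContDiff ℝ ∞ Complex.im := Complex.imCLM.contDiff

lemma contDiff_slitSource : ContDiff ℝ ∞ slitSource := by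
  rw [contDiff_iff_contDiffAt]
  intro w
  refine contDiffAt_mk contDiff_re.contDiffAt (ContDiff.contDiffAt ?_)
  exact contDiff_im.sub ((contDiff_softStep.comp contDiff_re).mul
    (Real.contDiff_arctan.comp contDiff_im))

lemma contDiff_slitTarget : ContDiff ℝ ∞ slitTarget := by
  rw [contDiff_iff_contDiffAt]
  intro w
  refine contDiffAt_mk (ContDiff.contDiffAt ?_) contDiff_im.contDiffAt
  exact contDiff_re.sub ((contDiff_softPos.comp contDiff_re).mul (contDiff_bump.comp contDiff_im))

/-- The generating function is `S(x, Y) = xY - softPos x * arctan Y`: the source is `(x, ∂S/∂x)` and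
the target is `(∂S/∂Y, Y)`. Both differentials are triangular with determinant `∂²S/∂x∂Y = 1 -
softStep x * bump Y > 0`. The off-diagonal entry `b` does not affect the area, so its value is left
unspecified. -/
lemma fderiv_slitSource (w : ℂ) : ∃ b : ℝ, ∀ u : ℂ, fderiv ℝ slitSource w u =
    ⟨u.re, b * u.re + (1 - softStep w.re * bump w.im) * u.im⟩ := by
  have hs : HasDerivAt softStep (deriv softStep w.re) w.re :=
    (contDiff_softStep.differentiable (by simp) _).hasDerivAt
  have ha : HasDerivAt Real.arctan (bump w.im) w.im := Real.hasDerivAt_arctan _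
  have h := hasFDerivAt_mk (hasFDerivAt_re w) ((hasFDerivAt_im w).sub
    ((hs.comp_hasFDerivAt w (hasFDerivAt_re w)).mul (ha.comp_hasFDerivAt w (hasFDerivAt_im w))))
  refine ⟨- (deriv softStep w.re * Real.arctan w.im), fun u => ?_⟩
  have h' : HasFDerivAt slitSource _ w := h
  rw [h'.fderiv]
  apply Complex.ext
  · simp
  · simp
    ring

lemma fderiv_slitTarget (w : ℂ) : ∃ b : ℝ, ∀ u : ℂ, fderiv ℝ slitTarget w u =
    ⟨(1 - softStep w.re * bump w.im) * u.re + b * u.im, u.im⟩ := by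
  have hs : HasDerivAt bump (deriv bump w.im) w.im :=
    (contDiff_bump.differentiable (by simp) _).hasDerivAt
  have h := hasFDerivAt_mk ((hasFDerivAt_re w).sub
    (((hasDerivAt_softPos w.re).comp_hasFDerivAt w (hasFDerivAt_re w)).mul
      (hs.comp_hasFDerivAt w (hasFDerivAt_im w)))) (hasFDerivAt_im w)
  refine ⟨- (softPos w.re * deriv bump w.im), fun u => ?_⟩
  have h' : HasFDerivAt slitTarget _ w := h
  rw [h'.fderiv]
  apply Complex.ext
  · simp
    ring
  · simp

lemma strictMono_sub_arctan (x : ℝ) : StrictMono fun y => y - softStep x * Real.arctan y := by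
  refine strictMono_of_hasDerivAt_pos (f' := fun y => 1 - softStep x * bump y) (fun y => ?_)
    fun y => by linarith [softStep_mul_bump_lt_one x y]
  exact (hasDerivAt_id y).sub ((Real.hasDerivAt_arctan y).const_mul _)

lemma abs_arctan_le (y : ℝ) : |Real.arctan y| ≤ 2 := by
  rw [abs_le]
  constructor <;> linarith [Real.neg_pi_div_two_lt_arctan y, Real.arctan_lt_pi_div_two y,
    Real.pi_le_four]

lemma abs_softStep_mul_arctan_le (x y : ℝ) : |softStep x * Real.arctan y| ≤ 2 := by
  rw [abs_mul, abs_of_pos (softStep_pos x)]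
  nlinarith [abs_arctan_le y, softStep_pos x, softStep_lt_one x, abs_nonneg (Real.arctan y)]

/-- Vertical lines are preserved; on each of them the map is strictly increasing and moves points by
at most `2`, so it takes every value. -/
lemma bijective_slitSource : Function.Bijective slitSource := by
  constructor
  · intro w w' h
    have h1 : w.re = w'.re :=
      (congrArg Complex.re h :)
    have h2 : w.im - softStep w.re * Real.arctan w.im =
      w'.im - softStep w'.re * Real.arctan w'.im :=
      (congrArg Complex.im h :)
    rw [← h1] at h2
    exact Complex.ext h1 ((strictMono_sub_arctan w.re).injective h2)
  · intro z
    have hc : Continuous fun y => y - softStep z.re * Real.arctan y := by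
      have := Real.continuous_arctan
      fun_prop
    have hb := fun y => abs_le.1 (abs_softStep_mul_arctan_le z.re y)
    obtain ⟨y, -, hy⟩ := intermediate_value_Icc (a := z.im - 2) (b := z.im + 2) (by linarith)
      hc.continuousOn (show z.im ∈ Set.Icc _ _ from
        ⟨by linarith [(hb (z.im - 2)).1], by linarith [(hb (z.im + 2)).2]⟩)
    exact ⟨⟨z.re, y⟩, Complex.ext rfl hy⟩

lemma injective_slitTarget : Function.Injective slitTarget := by
  intro w w' h
  have h2 : w.im = w'.im :=
      (congrArg Complex.im h :)
  have h1 : w.re - softPos w.re * bump w.im = w'.re - softPos w'.re * bump w'.im :=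
      (congrArg Complex.re h :)
  rw [← h2] at h1
  have hm : StrictMono fun x => x - softPos x * bump w.im := by
    refine strictMono_of_hasDerivAt_pos (f' := fun x => 1 - softStep x * bump w.im) (fun x => ?_)
      fun x => by linarith [softStep_mul_bump_lt_one x w.im]
    exact (hasDerivAt_id x).sub ((hasDerivAt_softPos x).mul_const _)
  exact Complex.ext (hm.injective h1) h2

/-- `slitSource` as an equivalence. -/
def slitSourceEquiv : ℂ ≃ ℂ := Equiv.ofBijective slitSource bijective_slitSource

/-- An area preserving embedding of `ℂ` into the complement of the nonpositive real axis. -/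
def slitEmbedding (z : ℂ) : ℂ := -slitTarget (slitSourceEquiv.symm z)

lemma slitEmbedding_slitSource (w : ℂ) : slitEmbedding (slitSource w) = -slitTarget w := by
  unfold slitEmbedding
  rw [show slitSource w = slitSourceEquiv w from rfl, Equiv.symm_apply_apply]

lemma contDiff_slitEmbedding : ContDiff ℝ ∞ slitEmbedding := by
  refine (contDiff_slitTarget.comp (contDiff_symm_of_injective (f := slitSourceEquiv)
    contDiff_slitSource fun x u hu => ?_)).neg
  obtain ⟨b, hb⟩ := fderiv_slitSource x
  have hu' : fderiv ℝ slitSource x u = 0 := hu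
  rw [hb] at hu'
  have h1 : u.re = 0 := congrArg Complex.re hu'
  have h2 : b * u.re + (1 - softStep x.re * bump x.im) * u.im = 0 := congrArg Complex.im hu'
  rw [h1, mul_zero, zero_add] at h2
  refine Complex.ext h1 ((mul_eq_zero.1 h2).resolve_left ?_)
  linarith [softStep_mul_bump_lt_one x.re x.im]

/-- The differentials of `slitSource` and `slitTarget` have the same determinant `D ≠ 0`, so the
quotient has determinant `1`; the final sign change of the plane preserves area. -/
lemma areaPreservingOn_slitEmbedding : AreaPreservingOn slitEmbedding Set.univ where
  contDiffAt x _ := contDiff_slitEmbedding.contDiffAt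
  injOn := by
    refine Function.Injective.injOn fun x y h => ?_
    exact slitSourceEquiv.symm.injective (injective_slitTarget (neg_injective h))
  pullback x _ := by
    obtain ⟨w, rfl⟩ := bijective_slitSource.2 x
    have hd := (contDiff_slitEmbedding.differentiable (by simp) (slitSource w)).hasFDerivAt
    refine ⟨_, hd, fun u v => ?_⟩
    obtain ⟨b, hb⟩ := fderiv_slitSource w
    obtain ⟨c, hc⟩ := fderiv_slitTarget w
    have hw := softStep_mul_bump_lt_one w.re w.im
    set D := 1 - softStep w.re * bump w.im with hD
    have hD0 : D ≠ 0 := by rw [hD]; linarith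
    have hcomp : ∀ a, fderiv ℝ slitEmbedding (slitSource w) (fderiv ℝ slitSource w a) =
        -fderiv ℝ slitTarget w a := by
      intro a
      have h1 : HasFDerivAt (slitEmbedding ∘ slitSource) _ w :=
        hd.comp w (contDiff_slitSource.differentiable (by simp) w).hasFDerivAt
      have h2 : HasFDerivAt (fun w => -slitTarget w) _ w :=
        (contDiff_slitTarget.differentiable (by simp) w).hasFDerivAt.neg
      have h3 : slitEmbedding ∘ slitSource = fun w => -slitTarget w :=
        funext slitEmbedding_slitSource
      rw [h3] at h1
      exact DFunLike.congr_fun (h1.unique h2) a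
    have hsurj : ∀ u : ℂ, fderiv ℝ slitSource w ⟨u.re, (u.im - b * u.re) / D⟩ = u := by
      intro u
      rw [hb]
      refine Complex.ext rfl ?_
      simp only
      field_simp
      ring
    rw [← hsurj u, ← hsurj v, hcomp, hcomp, hc, hc, hsurj, hsurj]
    simp [Complex.mul_im]
    field_simp
    ring

/-- A target point on the real axis has `Y = 0`, where `bump` equals `1`, so its real part is `x -
softPos x < 0` before the final sign change. -/
lemma slitEmbedding_mem_slitPlane (z : ℂ) : slitEmbedding z ∈ Complex.slitPlane := by
  obtain ⟨w, rfl⟩ := bijective_slitSource.2 z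
  rw [slitEmbedding_slitSource, Complex.mem_slitPlane_iff]
  by_cases h : w.im = 0
  · left
    have := sub_softPos_neg w.re
    simp [slitTarget, h, bump]
    linarith
  · right
    simpa [slitTarget] using h

lemma norm_slitEmbedding_le (z : ℂ) : ‖slitEmbedding z‖ ≤ ‖z‖ + 3 := by
  obtain ⟨w, rfl⟩ := bijective_slitSource.2 z
  rw [slitEmbedding_slitSource, norm_neg]
  have him : |w.im - (slitSource w).im| ≤ 2 := by
    simpa [slitSource] using abs_softStep_mul_arctan_le w.re w.im
  have hre : |(slitTarget w).re| ≤ |w.re| + 1 := by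
    have h1 := neg_le_sub_softPos w.re
    have h2 := mul_pos (softPos_pos w.re) (bump_pos w.im)
    have h3 := mul_le_mul_of_nonneg_left (bump_le_one w.im) (softPos_pos w.re).le
    simp only [slitTarget]
    rw [abs_le]
    constructor
    · linarith
    · linarith [le_abs_self w.re]
  -- For large positive `x = w.re` the real part may move by about `x`, so `|X| ≤ |x| + 1` is used
  -- in place of a bound on `X - x`. Here `e` is the real part `X` of the target clamped to `[-|x|,
  -- |x|]`: replacing `x` by `e` does not increase the norm, and the remaining error is at most `1 +
  -- 2 = 3`.
  obtain ⟨e, he, he1⟩ : ∃ e : ℝ, |e| ≤ |w.re| ∧ |(slitTarget w).re - e| ≤ 1 := by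
    rcases le_or_gt |(slitTarget w).re| |w.re| with h | h
    · exact ⟨_, h, by simp⟩
    · rcases le_or_gt 0 (slitTarget w).re with h0 | h0
      · refine ⟨|w.re|, by simp, ?_⟩
        rw [abs_of_nonneg h0] at h hre
        rw [abs_le]
        constructor <;> linarith
      · refine ⟨-|w.re|, by simp, ?_⟩
        rw [abs_of_neg h0] at h hre
        rw [abs_le]
        constructor <;> linarith
  have hn : ‖(⟨e, (slitSource w).im⟩ : ℂ)‖ ≤ ‖slitSource w‖ := by
    rw [Complex.norm_def, Complex.norm_def]
    refine Real.sqrt_le_sqrt ?_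
    simp only [Complex.normSq_apply]
    have : e * e ≤ w.re * w.re := by nlinarith [sq_le_sq.2 he]
    simpa [slitSource] using this
  calc ‖slitTarget w‖ = ‖(⟨e, (slitSource w).im⟩ : ℂ) +
        ⟨(slitTarget w).re - e, w.im - (slitSource w).im⟩‖ := by
        congr 1
        apply Complex.ext <;> simp [slitTarget]
    _ ≤ ‖slitSource w‖ + (1 + 2) := by
        refine (norm_add_le _ _).trans (add_le_add hn ?_)
        exact (Complex.norm_le_abs_re_add_abs_im _).trans (add_le_add he1 him)
    _ = ‖slitSource w‖ + 3 := by norm_num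

lemma areaPreservingOn_rescale {f : ℂ → ℂ} (hf : AreaPreservingOn f Set.univ) {δ : ℝ}
    (hδ : δ ≠ 0) : AreaPreservingOn (fun z => δ • f (δ⁻¹ • z)) Set.univ where
  contDiffAt x _ := ((hf.contDiffAt (δ⁻¹ • x) trivial).comp x (by fun_prop)).const_smul δ
  injOn x _ y _ h := smul_right_injective _ (inv_ne_zero hδ)
    (hf.injOn trivial trivial (smul_right_injective _ hδ h))
  pullback x _ := by
    obtain ⟨f', hf', h2⟩ := hf.pullback (δ⁻¹ • x) trivial
    refine ⟨_, (hf'.comp x ((hasFDerivAt_id x).const_smul δ⁻¹)).const_smul δ, fun u v => ?_⟩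
    rw [← h2 u v]
    simp
    field_simp

/-- For all `A, ε > 0` there is an area preserving embedding of the plane into the slit plane that
maps each disc of area `s ≤ A` into the disc of area `s + ε`. -/
lemma exists_slit_embedding {A ε : ℝ} (hε : 0 < ε) :
    ∃ f : ℂ → ℂ, AreaPreservingOn f Set.univ ∧ (∀ z, f z ∈ Complex.slitPlane) ∧
      ∀ z, Real.pi * ‖z‖ ^ 2 ≤ A → Real.pi * ‖f z‖ ^ 2 ≤ Real.pi * ‖z‖ ^ 2 + ε := by
  -- Conjugation by the dilation `δ` turns the additive error `3` into `3δ`. For `‖z‖ ≤ √A` this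
  -- gives `(‖z‖ + 3δ)² - ‖z‖² ≤ 6δ√A + 9δ²`, which tends to `0` with `δ`.
  have hlim : Filter.Tendsto (fun δ : ℝ => Real.pi * (6 * δ * (√A) + 9 * δ ^ 2)) (𝓝[>] 0)
      (𝓝 0) := by
    have : Continuous fun δ : ℝ => Real.pi * (6 * δ * (√A) + 9 * δ ^ 2) := by fun_prop
    simpa using (this.tendsto 0).mono_left nhdsWithin_le_nhds
  obtain ⟨δ, hδε, hδ⟩ := ((hlim.eventually (gt_mem_nhds hε)).and self_mem_nhdsWithin).exists
  have hδ : 0 < δ := hδ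
  refine ⟨_, areaPreservingOn_rescale areaPreservingOn_slitEmbedding hδ.ne', fun z => ?_,
    fun z hz => ?_⟩
  · have h := slitEmbedding_mem_slitPlane (δ⁻¹ • z)
    rw [Complex.mem_slitPlane_iff] at h ⊢
    simp only [Complex.smul_re, Complex.smul_im, smul_eq_mul] at h ⊢
    rcases h with h | h
    · exact Or.inl (mul_pos hδ h)
    · exact Or.inr (mul_ne_zero hδ.ne' h)
  · have h1 : ‖δ • slitEmbedding (δ⁻¹ • z)‖ ≤ ‖z‖ + 3 * δ := by
      have h := mul_le_mul_of_nonneg_left (norm_slitEmbedding_le (δ⁻¹ • z)) hδ.le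
      rw [norm_smul, Real.norm_of_nonneg hδ.le]
      refine h.trans (le_of_eq ?_)
      rw [norm_smul, norm_inv, Real.norm_of_nonneg hδ.le]
      field_simp
    have h2 : ‖z‖ ≤ √A := by
      refine Real.le_sqrt_of_sq_le ?_
      nlinarith [Real.two_le_pi, sq_nonneg ‖z‖]
    have h3 : ‖δ • slitEmbedding (δ⁻¹ • z)‖ ^ 2 ≤ ‖z‖ ^ 2 + (6 * δ * (√A) + 9 * δ ^ 2) := by
      have h4 := pow_le_pow_left₀ (norm_nonneg _) h1 2
      nlinarith [mul_le_mul_of_nonneg_left h2 hδ.le]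
    calc Real.pi * ‖δ • slitEmbedding (δ⁻¹ • z)‖ ^ 2
        ≤ Real.pi * (‖z‖ ^ 2 + (6 * δ * (√A) + 9 * δ ^ 2)) :=
          mul_le_mul_of_nonneg_left h3 Real.pi_pos.le
      _ ≤ _ := by rw [mul_add]; linarith

/-! ### Polar coordinates -/

/-- Symplectic polar coordinates: the area `π|z|²` and the argument, rescaled such that the disc of
area `a` becomes the rectangle `(0, 1) × (-a / 2, a / 2)`. -/
def polar (a : ℝ) (z : ℂ) : ℂ :=
  ⟨Real.pi / a * Complex.normSq z, a / (2 * Real.pi) * (Complex.log z).im⟩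

/-- The inverse of `polar A`, after a shift by `c` of the first coordinate. -/
def polarInv (A c : ℝ) (w : ℂ) : ℂ :=
  ⟨√(A / Real.pi * (w.re + c)) * Real.cos (2 * Real.pi / A * w.im),
    √(A / Real.pi * (w.re + c)) * Real.sin (2 * Real.pi / A * w.im)⟩

/-- In polar coordinates `d(πρ²/a) ∧ d(aθ/2π) = ρ dρ ∧ dθ`. Smoothness and the derivative of the
angle come from the holomorphic logarithm. -/
lemma areaPreservingOn_polar {a : ℝ} (ha : 0 < a) :
    AreaPreservingOn (polar a) Complex.slitPlane where
  contDiffAt z hz := by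
    have hl : ContDiffAt ℝ ∞ Complex.log z := (Complex.contDiffAt_log hz).restrict_scalars ℝ
    refine contDiffAt_mk ?_ ?_
    · refine ContDiff.contDiffAt ?_
      simp only [Complex.normSq_apply]
      have h1 := contDiff_re
      have h2 := contDiff_im
      fun_prop
    · exact contDiffAt_const.mul (contDiff_im.contDiffAt.comp z hl)
  injOn z hz w hw h := by
    have h1 : Real.pi / a * Complex.normSq z = Real.pi / a * Complex.normSq w :=
      (congrArg Complex.re h :)
    have h2 : a / (2 * Real.pi) * (Complex.log z).im = a / (2 * Real.pi) * (Complex.log w).im :=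
      (congrArg Complex.im h :)
    have hpi := Real.pi_pos
    have h1' := mul_left_cancel₀ (by positivity) h1
    have h2' := mul_left_cancel₀ (by positivity) h2
    have hn : ‖z‖ = ‖w‖ := by rw [Complex.norm_def, Complex.norm_def, h1']
    rw [Complex.log_im, Complex.log_im] at h2'
    exact Complex.ext_norm_arg hn h2'
  pullback z hz := by
    have hpi := Real.pi_pos
    have hl : HasFDerivAt Complex.log _ z := (Complex.hasDerivAt_log hz).complexToReal_fderiv
    have h1 := (((hasFDerivAt_re z).mul (hasFDerivAt_re z)).add
      ((hasFDerivAt_im z).mul (hasFDerivAt_im z))).const_mul (Real.pi / a)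
    have h2 := ((hasFDerivAt_im _).comp z hl).const_mul (a / (2 * Real.pi))
    refine ⟨_, hasFDerivAt_mk h1 h2, fun u v => ?_⟩
    have hz0 : z.re ^ 2 + z.im ^ 2 ≠ 0 := by
      have := Complex.normSq_eq_zero.not.2 (Complex.slitPlane_ne_zero hz)
      rwa [Complex.normSq_apply, ← sq, ← sq] at this
    have hn : Complex.normSq z = z.re ^ 2 + z.im ^ 2 := by rw [Complex.normSq_apply, sq, sq]
    simp [Complex.mul_im, Complex.inv_re, Complex.inv_im, hn]
    field_simp
    ring

lemma polar_re (a : ℝ) (z : ℂ) : (polar a z).re = Real.pi * ‖z‖ ^ 2 / a := by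
  simp only [polar, Complex.normSq_eq_norm_sq]
  ring

lemma abs_polar_im {a : ℝ} (ha : 0 < a) {z : ℂ} (hz : z ∈ Complex.slitPlane) :
    |(polar a z).im| < a / 2 := by
  have hpi := Real.pi_pos
  have h1 : |z.arg| < Real.pi := by
    refine abs_lt.2 ⟨Complex.neg_pi_lt_arg z, lt_of_le_of_ne (Complex.arg_le_pi z) ?_⟩
    exact Complex.slitPlane_arg_ne_pi hz
  simp only [polar, Complex.log_im, abs_mul]
  rw [abs_of_pos (by positivity)]
  calc a / (2 * Real.pi) * |z.arg| < a / (2 * Real.pi) * Real.pi :=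
        mul_lt_mul_of_pos_left h1 (by positivity)
    _ = a / 2 := by field_simp

lemma norm_polarInv_sq {A c : ℝ} (hA : 0 < A) {w : ℂ} (hw : -c < w.re) :
    Real.pi * ‖polarInv A c w‖ ^ 2 = A * (w.re + c) := by
  have hpi := Real.pi_pos
  have h0 : 0 ≤ A / Real.pi * (w.re + c) := mul_nonneg (by positivity) (by linarith)
  rw [← Complex.normSq_eq_norm_sq, Complex.normSq_apply]
  simp only [polarInv]
  generalize hφ : 2 * Real.pi / A * w.im = φ
  have h1 := Real.sq_sqrt h0
  have h2 := Real.sin_sq_add_cos_sq φ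
  calc _ = Real.pi * (√(A / Real.pi * (w.re + c)) ^ 2 *
        (Real.sin φ ^ 2 + Real.cos φ ^ 2)) := by ring
    _ = _ := by
      rw [h1, h2]
      field_simp

/-- The condition `-c < w.re` keeps the radius positive, and `|w.im| < A / 2` keeps the angle in
`(-π, π)`, where cosine and sine determine it. The shift `c` makes room for the slightly negative
values that a soft minimum of positive numbers can take. -/
lemma areaPreservingOn_polarInv {A c : ℝ} (hA : 0 < A) :
    AreaPreservingOn (polarInv A c) {w | -c < w.re ∧ |w.im| < A / 2} where
  contDiffAt w hw := by
    have hpi := Real.pi_pos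
    have h0 : 0 < A / Real.pi * (w.re + c) := mul_pos (by positivity) (by linarith [hw.1])
    have h1 := contDiff_re
    have h2 := contDiff_im
    have hs : ContDiffAt ℝ ∞ (fun w : ℂ => √(A / Real.pi * (w.re + c))) w :=
      ContDiffAt.sqrt (ContDiff.contDiffAt (by fun_prop)) h0.ne'
    have hφ : ContDiff ℝ ∞ (fun w : ℂ => 2 * Real.pi / A * w.im) := by fun_prop
    exact contDiffAt_mk (hs.mul (Real.contDiff_cos.comp hφ).contDiffAt)
      (hs.mul (Real.contDiff_sin.comp hφ).contDiffAt)
  injOn w hw w' hw' h := by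
    have hpi := Real.pi_pos
    have h1 := norm_polarInv_sq hA hw.1
    rw [h, norm_polarInv_sq hA hw'.1] at h1
    have hre : w.re = w'.re := by
      have := mul_left_cancel₀ hA.ne' h1
      linarith
    refine Complex.ext hre ?_
    have h0 : 0 < √(A / Real.pi * (w.re + c)) :=
      Real.sqrt_pos.2 (mul_pos (by positivity) (by linarith [hw.1]))
    have hc : √(A / Real.pi * (w.re + c)) * Real.cos (2 * Real.pi / A * w.im) =
        √(A / Real.pi * (w'.re + c)) * Real.cos (2 * Real.pi / A * w'.im) :=
      (congrArg Complex.re h :)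
    have hs : √(A / Real.pi * (w.re + c)) * Real.sin (2 * Real.pi / A * w.im) =
        √(A / Real.pi * (w'.re + c)) * Real.sin (2 * Real.pi / A * w'.im) :=
      (congrArg Complex.im h :)
    rw [← hre] at hc hs
    have hang : ((2 * Real.pi / A * w.im : ℝ) : Real.Angle) = (2 * Real.pi / A * w'.im : ℝ) :=
      Real.Angle.cos_sin_inj (mul_left_cancel₀ h0.ne' hc) (mul_left_cancel₀ h0.ne' hs)
    have hb : ∀ y : ℝ, |y| < A / 2 → 2 * Real.pi / A * y ∈ Set.Ioc (-Real.pi) Real.pi := by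
      intro y hy
      have hy' := abs_lt.1 hy
      constructor
      · calc -Real.pi = 2 * Real.pi / A * (-(A / 2)) := by field_simp
          _ < _ := mul_lt_mul_of_pos_left hy'.1 (by positivity)
      · refine le_of_lt ?_
        calc _ < 2 * Real.pi / A * (A / 2) := mul_lt_mul_of_pos_left hy'.2 (by positivity)
          _ = Real.pi := by field_simp
    have heq := congrArg Real.Angle.toReal hang
    rw [Real.Angle.toReal_coe_eq_self_iff_mem_Ioc.2 (hb _ hw.2),
      Real.Angle.toReal_coe_eq_self_iff_mem_Ioc.2 (hb _ hw'.2)] at heq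
    exact mul_left_cancel₀ (by positivity) heq
  pullback w hw := by
    have hpi := Real.pi_pos
    have h0 : 0 < A / Real.pi * (w.re + c) := mul_pos (by positivity) (by linarith [hw.1])
    have hs := (((hasFDerivAt_re w).add_const c).const_mul (A / Real.pi)).sqrt h0.ne'
    have hφ := (hasFDerivAt_im w).const_mul (2 * Real.pi / A)
    refine ⟨_, hasFDerivAt_mk (hs.mul hφ.cos) (hs.mul hφ.sin), fun u v => ?_⟩
    have hr : √(A / Real.pi * (w.re + c)) ≠ 0 := (Real.sqrt_pos.2 h0).ne'
    simp only [ContinuousLinearMap.comp_apply, ContinuousLinearMap.prod_apply, Complex.mul_im]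
    simp
    generalize √(A / Real.pi * (w.re + c)) = ρ at *
    generalize 2 * Real.pi / A * w.im = φ
    have h2 := Real.sin_sq_add_cos_sq φ
    field_simp
    linear_combination (4 * ρ ^ 2 * Real.pi ^ 2 * A ^ 2) * (u.im * v.re - u.re * v.im) * h2

/-! ### Straightening the union of the cylinders -/

/-- The weights of the soft minimum: the partial derivatives of `softMin`. -/
def softWeight {n : ℕ} (β : ℝ) (q : Fin n → ℝ) (k : Fin n) : ℝ :=
  Real.exp (-β * q k) / ∑ j, Real.exp (-β * q j)

/-- A smooth approximation of the minimum of `n` real numbers. -/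
def softMin {n : ℕ} (β : ℝ) (q : Fin n → ℝ) : ℝ := -(1 / β) * Real.log (∑ j, Real.exp (-β * q j))

section softMin

variable {n : ℕ} [NeZero n]

lemma sum_exp_pos (β : ℝ) (q : Fin n → ℝ) : 0 < ∑ j, Real.exp (-β * q j) :=
  Finset.sum_pos (fun _ _ => Real.exp_pos _) Finset.univ_nonempty

lemma sum_softWeight (β : ℝ) (q : Fin n → ℝ) : ∑ k, softWeight β q k = 1 := by
  simp only [softWeight]
  rw [← Finset.sum_div, div_self (sum_exp_pos β q).ne']

lemma softMin_le {β : ℝ} (hβ : 0 < β) (q : Fin n → ℝ) (k : Fin n) : softMin β q ≤ q k := by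
  have h1 : Real.exp (-β * q k) ≤ ∑ j, Real.exp (-β * q j) :=
    Finset.single_le_sum (f := fun j => Real.exp (-β * q j)) (fun _ _ => (Real.exp_pos _).le)
      (Finset.mem_univ k)
  have h2 := (Real.le_log_iff_exp_le (sum_exp_pos β q)).2 h1
  unfold softMin
  have h3 := mul_le_mul_of_nonneg_left h2 (by positivity : 0 ≤ 1 / β)
  have h4 : 1 / β * (-β * q k) = -q k := by field_simp
  linarith

/-- For positive `q` every exponential is below `1`, so the sum inside the logarithm is below `n`:
the soft minimum falls below zero by less than `log n / β`. -/
lemma lt_softMin {β c : ℝ} (hβ : 0 < β) (hc : (n : ℝ) ≤ Real.exp (β * c)) (q : Fin n → ℝ)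
    (hq : ∀ k, 0 < q k) : -c < softMin β q := by
  have h1 : ∑ j, Real.exp (-β * q j) < n := by
    calc _ < ∑ _j : Fin n, (1 : ℝ) := by
          refine Finset.sum_lt_sum_of_nonempty Finset.univ_nonempty fun j _ => ?_
          rw [Real.exp_lt_one_iff]
          nlinarith [hq j]
      _ = n := by simp
  have h2 := (Real.log_lt_iff_lt_exp (sum_exp_pos β q)).2 (h1.trans_le hc)
  unfold softMin
  have h3 := mul_lt_mul_of_pos_left h2 (by positivity : 0 < 1 / β)
  have h4 : 1 / β * (β * c) = c := by field_simp
  linarith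

lemma softMin_add_const {β : ℝ} (hβ : β ≠ 0) (q : Fin n → ℝ) (s : ℝ) :
    softMin β (fun k => q k + s) = softMin β q + s := by
  have h : ∑ j, Real.exp (-β * (q j + s)) = (∑ j, Real.exp (-β * q j)) * Real.exp (-β * s) := by
    rw [Finset.sum_mul]
    exact Finset.sum_congr rfl fun j _ => by rw [mul_add, Real.exp_add]
  unfold softMin
  rw [h, Real.log_mul (sum_exp_pos β q).ne' (Real.exp_pos _).ne', Real.log_exp]
  field_simp
  ring

/-- The symplectic map that takes `softMin` of the real parts to the real part of the last
coordinate, and the sum of the imaginary parts to its imaginary part. -/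
def straighten (β : ℝ) (z : Cn n) : Cn n := fun k =>
  if k = ⊤ then ⟨softMin β fun j => (z j).re, ∑ j, (z j).im⟩
  else ⟨(z k).re - (z ⊤).re, (z k).im - softWeight β (fun j => (z j).re) k * ∑ j, (z j).im⟩

lemma contDiff_straighten (β : ℝ) : ContDiff ℝ ∞ (straighten (n := n) β) := by
  have hre : ∀ j, ContDiff ℝ ∞ fun z : Cn n => (z j).re := fun j =>
    contDiff_re.comp (contDiff_apply ℝ ℂ j)
  have him : ∀ j, ContDiff ℝ ∞ fun z : Cn n => (z j).im := fun j =>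
    contDiff_im.comp (contDiff_apply ℝ ℂ j)
  have he : ∀ j, ContDiff ℝ ∞ fun z : Cn n => Real.exp (-β * (z j).re) := fun j =>
    Real.contDiff_exp.comp (contDiff_const.mul (hre j))
  have hZ : ContDiff ℝ ∞ fun z : Cn n => ∑ j, Real.exp (-β * (z j).re) :=
    ContDiff.sum fun j _ => he j
  have hS : ContDiff ℝ ∞ fun z : Cn n => ∑ j, (z j).im := ContDiff.sum fun j _ => him j
  rw [contDiff_iff_contDiffAt]
  intro z
  rw [contDiffAt_pi]
  intro k
  by_cases hk : k = ⊤
  · simp only [straighten, hk, if_true]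
    exact contDiffAt_mk (contDiff_const.mul (hZ.log fun z =>
      (sum_exp_pos β fun j => (z j).re).ne')).contDiffAt hS.contDiffAt
  · simp only [straighten, hk, if_false]
    exact contDiffAt_mk ((hre k).sub (hre ⊤)).contDiffAt ((him k).sub (((he k).div hZ fun z =>
      (sum_exp_pos β fun j => (z j).re).ne').mul hS)).contDiffAt

/-- The differences of the real parts determine them up to a common shift, and `softMin` detects the
shift. The weights are then known, so the sum of the imaginary parts gives back all of them, the
last one by subtraction. -/
lemma injective_straighten {β : ℝ} (hβ : β ≠ 0) : Function.Injective (straighten (n := n) β) := by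
  intro z z' h
  have htop : (⟨softMin β fun j => (z j).re, ∑ j, (z j).im⟩ : ℂ) =
      ⟨softMin β fun j => (z' j).re, ∑ j, (z' j).im⟩ := by
    simpa [straighten] using congrFun h ⊤
  have hT : softMin β (fun j => (z j).re) = softMin β fun j => (z' j).re :=
    (congrArg Complex.re htop :)
  have hS : ∑ j, (z j).im = ∑ j, (z' j).im := (congrArg Complex.im htop :)
  have hk : ∀ k, k ≠ ⊤ → (z k).re - (z ⊤).re = (z' k).re - (z' ⊤).re ∧
      (z k).im - softWeight β (fun j => (z j).re) k * ∑ j, (z j).im =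
        (z' k).im - softWeight β (fun j => (z' j).re) k * ∑ j, (z' j).im := by
    intro k hk
    have := congrFun h k
    simp only [straighten, hk, if_false] at this
    exact ⟨(congrArg Complex.re this :), (congrArg Complex.im this :)⟩
  have hre' : ∀ k, (z k).re = (z' k).re + ((z ⊤).re - (z' ⊤).re) := by
    intro k
    by_cases h : k = ⊤
    · rw [h]; ring
    · linarith [(hk k h).1]
  have h0 : (z ⊤).re - (z' ⊤).re = 0 := by
    have h2 : (fun j => (z j).re) = fun j => (z' j).re + ((z ⊤).re - (z' ⊤).re) := funext hre'
    rw [h2, softMin_add_const hβ] at hT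
    linarith
  have hre : ∀ k, (z k).re = (z' k).re := fun k => by rw [hre' k, h0, add_zero]
  have him : ∀ k, k ≠ ⊤ → (z k).im = (z' k).im := by
    intro k hk'
    have h2 := (hk k hk').2
    simp only [hre, hS] at h2
    linarith
  have him' : (z ⊤).im = (z' ⊤).im := by
    rw [← Finset.add_sum_erase _ _ (Finset.mem_univ (⊤ : Fin n)),
      ← Finset.add_sum_erase _ _ (Finset.mem_univ (⊤ : Fin n)),
      Finset.sum_congr rfl fun k hk' => him k (Finset.ne_of_mem_erase hk')] at hS
    linarith
  funext k
  refine Complex.ext (hre k) ?_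
  by_cases h : k = ⊤
  · rw [h, him']
  · exact him k h

lemma hasFDerivAt_softMin {β : ℝ} (hβ : β ≠ 0) (z : Cn n) :
    ∃ T' : Cn n →L[ℝ] ℝ, HasFDerivAt (fun z : Cn n => softMin β fun j => (z j).re) T' z ∧
      ∀ u, T' u = ∑ j, softWeight β (fun j => (z j).re) j * (u j).re := by
  have he : ∀ j, HasFDerivAt (fun z : Cn n => Real.exp (-β * (z j).re)) _ z := fun j =>
    (((hasFDerivAt_re (z j)).comp z (hasFDerivAt_apply j z)).const_mul (-β)).exp
  have hZ := HasFDerivAt.fun_sum (u := Finset.univ) fun j _ => he j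
  refine ⟨_, (hZ.log (sum_exp_pos β fun j => (z j).re).ne').const_mul (-(1 / β)), fun u => ?_⟩
  have h0 := (sum_exp_pos β fun j => (z j).re).ne'
  simp [softWeight, Finset.mul_sum]
  refine Finset.sum_congr rfl fun j _ => ?_
  field_simp

lemma hasFDerivAt_softWeight (β : ℝ) (z : Cn n) (k : Fin n) :
    ∃ w' : Cn n →L[ℝ] ℝ, HasFDerivAt (fun z : Cn n => softWeight β (fun j => (z j).re) k) w' z ∧
      ∀ u, w' u = -β * softWeight β (fun j => (z j).re) k *
        ((u k).re - ∑ j, softWeight β (fun j => (z j).re) j * (u j).re) := by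
  have he : ∀ j, HasFDerivAt (fun z : Cn n => Real.exp (-β * (z j).re)) _ z := fun j =>
    (((hasFDerivAt_re (z j)).comp z (hasFDerivAt_apply j z)).const_mul (-β)).exp
  have hZ := HasFDerivAt.fun_sum (u := Finset.univ) fun j _ => he j
  have h0 := (sum_exp_pos β fun j => (z j).re).ne'
  have heq : (fun z : Cn n => softWeight β (fun j => (z j).re) k) =
      (fun z : Cn n => Real.exp (-β * (z k).re)) * fun z => (∑ j, Real.exp (-β * (z j).re))⁻¹ :=
    funext fun z => div_eq_mul_inv _ _
  rw [heq]
  refine ⟨_, (he k).mul ((hasDerivAt_inv h0).comp_hasFDerivAt z hZ), fun u => ?_⟩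
  have h1 : ∑ j, softWeight β (fun j => (z j).re) j * (u j).re =
      (∑ j, Real.exp (-β * (z j).re) * (u j).re) / ∑ j, Real.exp (-β * (z j).re) := by
    rw [Finset.sum_div]
    exact Finset.sum_congr rfl fun j _ => by simp only [softWeight]; ring
  have h2 : (∑ j, Real.exp (-β * (z j).re) • -β • Complex.reCLM ∘SL
      ContinuousLinearMap.proj (R := ℝ) (φ := fun _ : Fin n => ℂ) j) u =
      -β * ∑ j, Real.exp (-β * (z j).re) * (u j).re := by
    rw [_root_.sum_apply, Finset.mul_sum]
    refine Finset.sum_congr rfl fun j _ => ?_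
    simp
    ring
  rw [h1]
  simp only [_root_.add_apply, _root_.smul_apply, h2, smul_eq_mul,
    ContinuousLinearMap.comp_apply, ContinuousLinearMap.proj_apply, Complex.reCLM_apply, softWeight]
  field_simp
  ring

/-- The algebra behind `conformalOn_straighten`. -/
lemma sum_straighten_form {n : ℕ} (β S : ℝ) (w a b a' b' : Fin n → ℝ) (hw : ∑ k, w k = 1) (t : Fin n) :
    ∑ k, ((b k - (w k * ∑ j, b j + S * (-β * w k * (a k - ∑ j, w j * a j)))) * (a' k - a' t) -
      (a k - a t) * (b' k - (w k * ∑ j, b' j + S * (-β * w k * (a' k - ∑ j, w j * a' j))))) +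
      ((∑ j, b j) * (∑ j, w j * a' j) - (∑ j, w j * a j) * ∑ j, b' j) =
    ∑ k, (b k * a' k - a k * b' k) := by
  set m := ∑ j, w j * a j with hm
  set m' := ∑ j, w j * a' j with hm'
  set B := ∑ j, b j with hB
  set B' := ∑ j, b' j with hB'
  have h : ∀ k, (b k - (w k * B + S * (-β * w k * (a k - m)))) * (a' k - a' t) -
      (a k - a t) * (b' k - (w k * B' + S * (-β * w k * (a' k - m')))) =
      (b k * a' k - a k * b' k) + (-a' t) * b k + a t * b' k +
      (-B + S * β * (a t - m)) * (w k * a' k) + (B' + S * β * (m' - a' t)) * (w k * a k) +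
      (B * a' t - B' * a t + S * β * (m * a' t - m' * a t)) * w k := fun k => by ring
  simp only [h, Finset.sum_add_distrib, ← Finset.mul_sum, hw, ← hm, ← hm', ← hB, ← hB']
  ring

lemma sum_eq_sum_add_of_eq_zero {n : ℕ} {f g : Fin n → ℝ} {t : Fin n}
    (h : ∀ k, k ≠ t → f k = g k) (ht : g t = 0) : ∑ k, f k = ∑ k, g k + f t := by
  rw [← Finset.add_sum_erase _ f (Finset.mem_univ t), ← Finset.add_sum_erase _ g
    (Finset.mem_univ t), ht, zero_add, add_comm,
    Finset.sum_congr rfl fun k hk => h k (Finset.ne_of_mem_erase hk)]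

/-- This is the cotangent lift of `q ↦ (qₖ - q_⊤ for k ≠ ⊤, softMin q)`, with real parts as
positions and imaginary parts as momenta. Since the weights sum to `1`, the momentum conjugate to
`softMin` is the plain sum `∑ pⱼ`, and the others are `pₖ - wₖ ∑ pⱼ`. -/
lemma conformalOn_straighten {β : ℝ} (hβ : β ≠ 0) :
    ConformalOn 1 (straighten (n := n) β) Set.univ where
  contDiffAt _ _ := (contDiff_straighten β).contDiffAt
  injOn := (injective_straighten hβ).injOn
  pullback z _ := by
    obtain ⟨T', hT, hT'⟩ := hasFDerivAt_softMin hβ z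
    choose w' hw hw' using hasFDerivAt_softWeight β z
    have hre := fun k => (hasFDerivAt_re (z k)).comp z (hasFDerivAt_apply (𝕜 := ℝ) k z)
    have him := fun k => (hasFDerivAt_im (z k)).comp z (hasFDerivAt_apply (𝕜 := ℝ) k z)
    have hS := HasFDerivAt.fun_sum (u := Finset.univ) fun k _ => him k
    set q : Fin n → ℝ := fun j => (z j).re with hq
    set S := ∑ j, (z j).im with hSdef
    have h : ∀ k, ∃ L : Cn n →L[ℝ] ℂ, HasFDerivAt (fun z => straighten β z k) L z ∧
        ∀ u, L u = if k = ⊤ then ⟨∑ j, softWeight β q j * (u j).re, ∑ j, (u j).im⟩ else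
          ⟨(u k).re - (u ⊤).re, (u k).im - (softWeight β q k * ∑ j, (u j).im + S *
            (-β * softWeight β q k * ((u k).re - ∑ j, softWeight β q j * (u j).re)))⟩ := by
      intro k
      by_cases hk : k = ⊤
      · simp only [straighten, hk, if_true]
        refine ⟨_, hasFDerivAt_mk hT hS, fun u => ?_⟩
        apply Complex.ext <;> simp [hT']
      · simp only [straighten, hk, if_false]
        refine ⟨_, hasFDerivAt_mk ((hre k).sub (hre ⊤)) ((him k).sub ((hw k).mul hS)),
          fun u => ?_⟩
        apply Complex.ext <;> simp [hw', hSdef, hq]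
    choose L hL hL' using h
    refine ⟨ContinuousLinearMap.pi L, hasFDerivAt_pi.2 hL, fun u v => ?_⟩
    have hsum := sum_straighten_form β S (softWeight β q) (fun k => (u k).re) (fun k => (u k).im)
      (fun k => (v k).re) (fun k => (v k).im) (sum_softWeight β q) ⊤
    have him : ∀ x y : ℂ, (x * conj y).im = x.im * y.re - x.re * y.im := fun x y => by
      simp [Complex.mul_im]
      ring
    simp only [ContinuousLinearMap.pi_apply, him, one_mul]
    rw [← hsum]
    -- The expression valid for `k ≠ ⊤` vanishes at `k = ⊤`, where the differences of real parts are
    -- zero; it may therefore be summed over all `k`, with the true last term added.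
    refine (sum_eq_sum_add_of_eq_zero (t := ⊤) (fun k hk => ?_) ?_).trans (congrArg _ ?_)
    · simp only [hL', hk, if_false]
    · simp
    · simp only [hL', if_true]

end softMin

/-! ### The two embeddings -/

lemma ConformalOn.mono {n : ℕ} {α : ℝ} {f : Cn n → Cn n} {s t : Set (Cn n)}
    (hf : ConformalOn α f t) (h : s ⊆ t) : ConformalOn α f s where
  contDiffAt x hx := hf.contDiffAt x (h hx)
  injOn := hf.injOn.mono h
  pullback x hx := hf.pullback x (h hx)

lemma areaPreservingOn_id (s : Set ℂ) : AreaPreservingOn id s where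
  contDiffAt _ _ := contDiffAt_id
  injOn := Set.injOn_id s
  pullback x _ := ⟨_, hasFDerivAt_id x, fun _ _ => rfl⟩

/-- A union of cylinders, one over a disc of area `xₖ` in each coordinate, embeds into the cylinder
over a disc of area `R` as soon as `R > ∑ xₖ`. -/
lemma exists_embedding_into_cylinder {n : ℕ} [NeZero n] {x : Fin n → ℝ} (hx : ∀ k, 0 < x k)
    {R : ℝ} (hR : ∑ k, x k < R) :
    ∃ F : Cn n → Cn n, ConformalOn 1 F Set.univ ∧
      ∀ z, (∃ k, Real.pi * ‖z k‖ ^ 2 ≤ x k) → Real.pi * ‖F z ⊤‖ ^ 2 < R := by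
  have hn : (0 : ℝ) < n := Nat.cast_pos.2 (NeZero.pos n)
  -- Half of the gap `R - ∑ xₖ` is shared equally among the `n` coordinates.
  obtain ⟨ε, hε, hεR⟩ : ∃ ε > 0, ∑ k, x k + n * ε < R := by
    refine ⟨(R - ∑ k, x k) / (2 * n), div_pos (by linarith) (by positivity), ?_⟩
    have : n * ((R - ∑ k, x k) / (2 * n)) = (R - ∑ k, x k) / 2 := by field_simp
    linarith
  set a : Fin n → ℝ := fun k => x k + ε with ha_def
  have ha : ∀ k, 0 < a k := fun k => add_pos (hx k) hε
  set A := ∑ k, a k with hA_def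
  have hA : 0 < A := Finset.sum_pos (fun k _ => ha k) Finset.univ_nonempty
  have hAR : A < R := by
    rw [hA_def, ha_def]
    simpa [Finset.sum_add_distrib] using hεR
  -- The other half of the gap is spent on the shift, with `A * (1 + c) = R`. The choice `β = n / c`
  -- below gives `exp (β * c) = exp n ≥ n`, as `lt_softMin` requires.
  set c := (R - A) / A with hc_def
  have hc : 0 < c := div_pos (by linarith) hA
  have hAc : A * (1 + c) = R := by rw [hc_def]; field_simp; ring
  set β := n / c with hβ_def
  have hβ : 0 < β := div_pos hn hc
  have hβc : (n : ℝ) ≤ Real.exp (β * c) := by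
    rw [hβ_def, div_mul_cancel₀ _ hc.ne']
    linarith [Real.add_one_le_exp (n : ℝ)]
  -- The error `ε / 2` keeps the image of a disc of area `xₖ` strictly inside area `aₖ = xₖ + ε`;
  -- the bound `R` on the areas covers every `xₖ`.
  obtain ⟨σ, hσ, hσs, hσn⟩ := exists_slit_embedding (A := R) (half_pos hε)
  -- `Q` is the product of half-strips that contains the image of the polar maps, and `V` is the
  -- half-strip on which `polarInv A c` is injective. The widths `aₖ` add up to `A`, which is why
  -- the last coordinate lands in `V`.
  let Q : Set (Cn n) := {w | ∀ k, 0 < (w k).re ∧ |(w k).im| < a k / 2}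
  let V : Set ℂ := {w | -c < w.re ∧ |w.im| < A / 2}
  have h1 : ConformalOn 1 (fun (z : Cn n) k => σ (z k)) Set.univ :=
    (conformalOn_pi fun _ => hσ).mono fun z _ k _ => trivial
  have h2 := conformalOn_pi fun k => areaPreservingOn_polar (ha k)
  have h3 : ConformalOn 1 (straighten (n := n) β) Q :=
    (conformalOn_straighten hβ.ne').mono (Set.subset_univ _)
  have h4 : ConformalOn 1 (fun (z : Cn n) k => (if k = ⊤ then polarInv A c else id) (z k))
      (Set.univ.pi fun k => if k = ⊤ then V else Set.univ) := by
    refine conformalOn_pi fun k => ?_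
    by_cases hk : k = ⊤
    · simp only [hk, if_true]
      exact areaPreservingOn_polarInv hA
    · simp only [hk, if_false]
      exact areaPreservingOn_id _
  have hst : ∀ w : Cn n, straighten β w ⊤ = ⟨softMin β fun j => (w j).re, ∑ j, (w j).im⟩ :=
    fun w => by simp [straighten]
  have m1 : Set.MapsTo (fun (z : Cn n) k => σ (z k)) Set.univ
      (Set.univ.pi fun _ => Complex.slitPlane) := fun z _ k _ => hσs _
  have m2 : Set.MapsTo (fun (z : Cn n) k => polar (a k) (z k))
      (Set.univ.pi fun _ => Complex.slitPlane) Q := by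
    intro z hz k
    refine ⟨?_, abs_polar_im (ha k) (hz k trivial)⟩
    rw [polar_re]
    have := norm_pos_iff.2 (Complex.slitPlane_ne_zero (hz k trivial))
    have := Real.pi_pos
    have := ha k
    positivity
  have mV : ∀ w ∈ Q, straighten β w ⊤ ∈ V := by
    intro w hw
    rw [hst]
    refine ⟨lt_softMin hβ hβc _ fun k => (hw k).1, ?_⟩
    calc |∑ j, (w j).im| ≤ ∑ j, |(w j).im| := Finset.abs_sum_le_sum_abs _ _
      _ < ∑ j, a j / 2 := Finset.sum_lt_sum_of_nonempty Finset.univ_nonempty fun j _ => (hw j).2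
      _ = A / 2 := by rw [hA_def, Finset.sum_div]
  have m3 : Set.MapsTo (straighten (n := n) β) Q
      (Set.univ.pi fun k => if k = ⊤ then V else Set.univ) := by
    intro w hw k _
    by_cases hk : k = ⊤
    · simp only [hk, if_true]
      exact mV w hw
    · simp only [hk, if_false, Set.mem_univ]
  have hF := h4.comp (h3.comp (h2.comp h1 m1) (m2.comp m1)) (m3.comp (m2.comp m1))
  simp only [mul_one] at hF
  refine ⟨_, hF, fun z ⟨k, hk⟩ => ?_⟩
  simp only [Function.comp_apply, if_true]
  set w : Cn n := fun k => polar (a k) (σ (z k)) with hw_def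
  have hwQ : w ∈ Q := m2 (m1 (Set.mem_univ z))
  -- The area of the last coordinate is `A * (softMin + c)`, so it remains to see that `softMin <
  -- 1`; this follows from the one index `k` with `π|zₖ|² ≤ xₖ`.
  rw [norm_polarInv_sq hA (mV w hwQ).1, hst, ← hAc]
  refine mul_lt_mul_of_pos_left (add_lt_add_left ?_ c) hA
  refine (softMin_le hβ _ k).trans_lt ?_
  have hxR : x k ≤ R :=
    (Finset.single_le_sum (f := x) (fun j _ => (hx j).le) (Finset.mem_univ k)).trans hR.le
  have := hσn (z k) (hk.trans hxR)
  rw [hw_def, polar_re, div_lt_one (ha k), ha_def]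
  simp only
  linarith

/-- The ball `B(r)` embeds into the complement of the coordinate hyperplanes in `B(R)` as soon as
`r < R`. -/
lemma exists_embedding_of_ball {n : ℕ} [NeZero n] {r R : ℝ} (h : r < R) :
    ∃ F : Cn n → Cn n, ConformalOn 1 F Set.univ ∧ ∀ z ∈ ball n r,
      (∀ k, 0 < Real.pi * ‖F z k‖ ^ 2) ∧ ∑ k, Real.pi * ‖F z k‖ ^ 2 < R := by
  have hn : (0 : ℝ) < n := Nat.cast_pos.2 (NeZero.pos n)
  obtain ⟨σ, hσ, hσs, hσn⟩ := exists_slit_embedding (A := r)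
    (show 0 < (R - r) / n from div_pos (by linarith) hn)
  refine ⟨fun z k => σ (z k), (conformalOn_pi fun _ => hσ).mono fun z _ k _ => trivial,
    fun z hz => ⟨fun k => ?_, ?_⟩⟩
  · have := norm_pos_iff.2 (Complex.slitPlane_ne_zero (hσs (z k)))
    have := Real.pi_pos
    positivity
  · have hz2 : ∑ k, Real.pi * ‖z k‖ ^ 2 < r := hz.2
    have hk : ∀ k, Real.pi * ‖z k‖ ^ 2 ≤ r := fun k =>
      (Finset.single_le_sum (f := fun k => Real.pi * ‖z k‖ ^ 2) (fun j _ => hz.1 j)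
        (Finset.mem_univ k)).trans hz2.le
    calc ∑ k, Real.pi * ‖σ (z k)‖ ^ 2 ≤ ∑ k, (Real.pi * ‖z k‖ ^ 2 + (R - r) / n) :=
          Finset.sum_le_sum fun k _ => hσn (z k) (hk k)
      _ = ∑ k, Real.pi * ‖z k‖ ^ 2 + (R - r) := by
          simp [Finset.sum_add_distrib]
          field_simp
      _ < R := by linarith

/-! ### Monotone domains -/

/-- Along a strictly decreasing direction, `Ω` is left before and entered after a boundary point
with positive coordinates. -/
lemma IsMonotone.eventually_of_mem_frontier {n : ℕ} {Ω : Set (Fin n → ℝ)} (hΩ : IsMonotone Ω)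
    {μ d : Fin n → ℝ} (hμ : μ ∈ frontier Ω) (hμ0 : ∀ k, 0 < μ k) (hd : ∀ k, d k < 0) :
    (∀ᶠ s in 𝓝[>] (0 : ℝ), μ + s • d ∈ Ω) ∧ ∀ᶠ s in 𝓝[<] (0 : ℝ), μ + s • d ∉ Ω := by
  obtain ⟨v, hv⟩ := hΩ.exists_normal μ hμ hμ0
  have hv0 := hΩ.normal_nonneg μ hμ hμ0 v hv
  obtain ⟨hvne, f, hf, hfμ, hfd, hev⟩ := hv
  have hneg : fderiv ℝ f μ d < 0 := by
    rw [hfd]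
    obtain ⟨j, hj⟩ := Function.ne_iff.1 hvne
    refine Finset.sum_neg' (fun k _ => mul_nonpos_of_nonneg_of_nonpos (hv0 k) (hd k).le)
      ⟨j, Finset.mem_univ j, mul_neg_of_pos_of_neg ((hv0 j).lt_of_ne' hj) (hd j)⟩
  have hline : HasDerivAt (fun s : ℝ => μ + s • d) d 0 := by
    simpa using ((hasDerivAt_id (0 : ℝ)).smul_const d).const_add μ
  have hD : HasDerivAt (fun s : ℝ => f (μ + s • d)) (fderiv ℝ f μ d) 0 := by
    have h1 : HasFDerivAt f (fderiv ℝ f μ) (μ + (0 : ℝ) • d) := by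
      simpa using (hf.differentiableAt (by simp)).hasFDerivAt
    exact h1.comp_hasDerivAt (0 : ℝ) hline
  have htend : Filter.Tendsto (fun s : ℝ => μ + s • d) (𝓝 0) (𝓝 μ) := by
    simpa using hline.continuousAt.tendsto
  have hev' := htend.eventually hev
  -- As `f μ = 0`, the quotient `f (μ + s • d) / s` is negative for small `s ≠ 0`: `f` is negative
  -- for `s > 0`, hence the point is in `Ω`, and positive for `s < 0`, hence it is outside.
  have hslope := (hasDerivAt_iff_tendsto_slope.1 hD).eventually (gt_mem_nhds hneg)
  constructor
  · filter_upwards [hev'.filter_mono nhdsWithin_le_nhds,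
      hslope.filter_mono (nhdsWithin_mono 0 fun s hs => (ne_of_gt hs)), self_mem_nhdsWithin]
      with s h1 h2 hs
    refine h1.1 ?_
    have hs : 0 < s := hs
    simp only [slope_def_field, zero_smul, add_zero, hfμ, sub_zero] at h2
    exact (div_neg_iff.1 h2).elim (fun h => absurd h.2 (by linarith)) fun h => h.1
  · filter_upwards [hev'.filter_mono nhdsWithin_le_nhds,
      hslope.filter_mono (nhdsWithin_mono 0 fun s hs => (ne_of_lt hs)), self_mem_nhdsWithin]
      with s h1 h2 hs hmem
    have hs : s < 0 := hs
    simp only [slope_def_field, zero_smul, add_zero, hfμ, sub_zero] at h2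
    have h3 := h1.2 hmem
    exact (div_neg_iff.1 h2).elim (fun h => by linarith [h.1]) fun h => by linarith [h.2]

/-- With a point `y`, a monotone `Ω` contains all points with positive coordinates smaller than
those of `y`. -/
lemma IsMonotone.mem_of_lt {n : ℕ} {Ω : Set (Fin n → ℝ)} (hΩ : IsMonotone Ω)
    {x y : Fin n → ℝ} (hx : ∀ k, 0 < x k) (hxy : ∀ k, x k < y k) (hy : y ∈ Ω) : x ∈ Ω := by
  by_contra hxΩ
  set d := x - y with hd_def
  have hd : ∀ k, d k < 0 := fun k => sub_neg.2 (hxy k)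
  -- On the segment from `y` (`t = 0`) to `x` (`t = 1`), `T = sup S` is the last time in the closure
  -- of `S`. All points of the segment have positive coordinates, so the condition on normals
  -- applies at time `T`. For `T < 1`, points just after `T` would still be in `Ω`, whether the
  -- point at `T` is interior or on the frontier.
  set S : Set ℝ := {t | t ∈ Set.Icc (0 : ℝ) 1 ∧ y + t • d ∈ Ω} with hS
  have h0 : (0 : ℝ) ∈ S := ⟨by simp, by simpa using hy⟩
  have hb : BddAbove S := ⟨1, fun t ht => ht.1.2⟩
  set T := sSup S with hT
  have hT0 : 0 ≤ T := le_csSup hb h0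
  have hT1 : T ≤ 1 := csSup_le ⟨0, h0⟩ fun t ht => ht.1.2
  have hcont : Continuous fun t : ℝ => y + t • d := by fun_prop
  have hcl : y + T • d ∈ closure Ω :=
    closure_minimal (s := S) (t := (fun t : ℝ => y + t • d) ⁻¹' closure Ω)
      (fun t ht => subset_closure ht.2) (isClosed_closure.preimage hcont)
      (csSup_mem_closure ⟨0, h0⟩ hb)
  have hpos : ∀ k, 0 < (y + T • d) k := by
    intro k
    have : (y + T • d) k = x k + (1 - T) * (y k - x k) := by
      simp [hd_def]
      ring
    rw [this]
    have := mul_nonneg (sub_nonneg.2 hT1) (sub_nonneg.2 (hxy k).le)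
    linarith [hx k]
  have hadd : ∀ s : ℝ, y + T • d + s • d = y + (T + s) • d := fun s => by
    rw [add_smul, add_assoc]
  have hafter : T < 1 → ¬ ∀ᶠ s in 𝓝[>] (0 : ℝ), y + T • d + s • d ∈ Ω := by
    intro hlt hev
    have hsmall : ∀ᶠ s in 𝓝[>] (0 : ℝ), s < 1 - T :=
      (gt_mem_nhds (by linarith : (0 : ℝ) < 1 - T)).filter_mono nhdsWithin_le_nhds
    obtain ⟨s, ⟨h1, h2⟩, h3⟩ := ((hev.and hsmall).and self_mem_nhdsWithin).exists
    have h3 : 0 < s := h3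
    rw [hadd] at h1
    have := le_csSup hb (show T + s ∈ S from ⟨⟨by linarith, by linarith⟩, h1⟩)
    linarith
  by_cases hint : y + T • d ∈ interior Ω
  · have hTlt : T < 1 := by
      refine hT1.lt_of_ne fun h => hxΩ ?_
      have := interior_subset hint
      rwa [h, one_smul, hd_def, add_sub_cancel] at this
    refine hafter hTlt ?_
    have hc : Filter.Tendsto (fun s : ℝ => y + T • d + s • d) (𝓝 0) (𝓝 (y + T • d)) := by
      have : Continuous fun s : ℝ => y + T • d + s • d := by fun_prop
      simpa using this.tendsto 0
    exact (hc.eventually (mem_interior_iff_mem_nhds.1 hint)).filter_mono nhdsWithin_le_nhds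
  · obtain ⟨h1, h2⟩ := hΩ.eventually_of_mem_frontier ⟨hcl, hint⟩ hpos hd
    rcases hT1.lt_or_eq with hlt | heq
    · exact hafter hlt h1
    -- Here `x` itself is on the frontier, so the points shortly before it are outside `Ω`. But `1 ∉
    -- S` and `sup S = 1`, so `S` has elements arbitrarily close to `1` from below.
    · obtain ⟨l, hl, hl2⟩ := mem_nhdsLT_iff_exists_Ioo_subset.1 h2
      have hl : l < 0 := hl
      obtain ⟨t, htS, htl⟩ := exists_lt_of_lt_csSup ⟨0, h0⟩ (show T + l < sSup S by linarith)
      have htne : t ≠ 1 := by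
        rintro rfl
        refine hxΩ ?_
        have := htS.2
        rwa [one_smul, hd_def, add_sub_cancel] at this
      have ht1 := htS.1.2.lt_of_ne htne
      refine hl2 (show t - T ∈ Set.Ioo l 0 from ⟨by linarith, by linarith⟩) ?_
      rw [hadd, add_sub_cancel]
      exact htS.2

/-! ### Symplectic maps between open subsets, as manifolds and as sets -/

/-- If `α ω` is `β` times the pullback of `ω` under `F`, then `F` restricts to symplectic embeddings
`(X, αω) → (Y, βω)`. -/
lemma ConformalOn.exists_isSymplecticEmbedding {n : ℕ} {F : Cn n → Cn n} {α β γ : ℝ} (hγ : γ ≠ 0)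
    (hF : ConformalOn γ F Set.univ) (hα : α ≠ 0) (hβ : β ≠ 0) (h : β * γ = α)
    {X Y : TopologicalSpace.Opens (Cn n)} (hXY : Set.MapsTo F X Y) :
    ∃ f : ((ofOpens n X).scale α hα).carrier → ((ofOpens n Y).scale β hβ).carrier,
      IsSymplecticEmbedding f := by
  have hFc : ContDiff ℝ ∞ F := contDiff_iff_contDiffAt.2 fun x => hF.contDiffAt x trivial
  let f : X → Y := fun x => ⟨F x, hXY x.2⟩
  have hval : (Subtype.val : Y → Cn n) ∘ f = F ∘ Subtype.val := rfl
  have hFv : ContMDiff 𝓘(ℝ, Cn n) 𝓘(ℝ, Cn n) ∞ (F ∘ (Subtype.val : X → Cn n)) :=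
    hFc.contMDiff.comp contMDiff_subtype_val
  have hf : ContMDiff 𝓘(ℝ, Cn n) 𝓘(ℝ, Cn n) ∞ f := by
    intro x
    rw [contMDiffAt_iff_target]
    refine ⟨Continuous.continuousAt ?_, hFv x⟩
    exact (hFc.continuous.comp continuous_subtype_val).subtype_mk _
  refine ⟨f, hf, ?_, fun (x : X) => ?_⟩
  · have h1 : Topology.IsEmbedding ((Subtype.val : Y → Cn n) ∘ f) :=
      (hF.isOpenEmbedding hγ).isEmbedding.comp Topology.IsEmbedding.subtypeVal
    exact Topology.IsEmbedding.of_comp hf.continuous continuous_subtype_val h1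
  · obtain ⟨F', hF', hF2⟩ := hF.pullback (x : Cn n) trivial
    have hx : MDifferentiableAt 𝓘(ℝ, Cn n) 𝓘(ℝ, Cn n) (Subtype.val : X → Cn n) x :=
      (contMDiff_subtype_val (n := ∞)).mdifferentiableAt (by simp)
    have hy : MDifferentiableAt 𝓘(ℝ, Cn n) 𝓘(ℝ, Cn n) (Subtype.val : Y → Cn n) (f x) :=
      (contMDiff_subtype_val (n := ∞)).mdifferentiableAt (by simp)
    have hfx : MDifferentiableAt 𝓘(ℝ, Cn n) 𝓘(ℝ, Cn n) f x := hf.mdifferentiableAt (by simp)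
    have hd : (mfderiv 𝓘(ℝ, Cn n) 𝓘(ℝ, Cn n) (Subtype.val : Y → Cn n) (f x)).comp
        (mfderiv 𝓘(ℝ, Cn n) 𝓘(ℝ, Cn n) f x) =
        F'.comp (mfderiv 𝓘(ℝ, Cn n) 𝓘(ℝ, Cn n) (Subtype.val : X → Cn n) x) := by
      rw [← mfderiv_comp x hy hfx, hval]
      have hFm : HasMFDerivAt 𝓘(ℝ, Cn n) 𝓘(ℝ, Cn n) F (x : Cn n) F' := hF'.hasMFDerivAt
      exact (hFm.comp x hx.hasMFDerivAt).mfderiv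
    refine ContinuousAlternatingMap.ext (M := Cn n) fun v => ?_
    have hd' : ∀ i, mfderiv 𝓘(ℝ, Cn n) 𝓘(ℝ, Cn n) (Subtype.val : Y → Cn n) (f x)
        (mfderiv 𝓘(ℝ, Cn n) 𝓘(ℝ, Cn n) f x (v i)) =
        F' (mfderiv 𝓘(ℝ, Cn n) 𝓘(ℝ, Cn n) (Subtype.val : X → Cn n) x (v i)) :=
      fun i => DFunLike.congr_fun hd (v i)
    change β * stdForm n (fun i => mfderiv 𝓘(ℝ, Cn n) 𝓘(ℝ, Cn n) (Subtype.val : Y → Cn n) (f x)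
      (mfderiv 𝓘(ℝ, Cn n) 𝓘(ℝ, Cn n) f x (v i))) = α * stdForm n (fun i =>
        mfderiv 𝓘(ℝ, Cn n) 𝓘(ℝ, Cn n) (Subtype.val : X → Cn n) x (v i))
    rw [← h, mul_assoc]
    exact congrArg (β * ·) ((congrArg (stdForm n) (funext hd')).trans (hF2 _ _))

/-- The domain of `c` is closed under rescaling forms, but need not contain `B(r)` or `Z(R)` with
the standard form. Sizes are therefore moved from the sets to the forms, and dilations enter as
conformal maps between rescaled manifolds. -/
lemma Capacity.mul_le_mul {n : ℕ} (c : Capacity n) {F : Cn n → Cn n} {α β γ : ℝ} (hα : 0 < α)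
    (hβ : 0 < β) (hγ : γ ≠ 0) (hF : ConformalOn γ F Set.univ) (h : β * γ = α)
    {X Y : TopologicalSpace.Opens (Cn n)} (hXY : Set.MapsTo F X Y) (hX : ofOpens n X ∈ c.dom)
    (hY : ofOpens n Y ∈ c.dom) :
    ENNReal.ofReal α * c.val (ofOpens n X) ≤ ENNReal.ofReal β * c.val (ofOpens n Y) := by
  rw [← c.conformal _ hX α hα, ← c.conformal _ hY β hβ]
  exact c.monotone _ (c.scale_mem _ hX α hα) _ (c.scale_mem _ hY β hβ)
    (hF.exists_isSymplecticEmbedding hγ hα.ne' hβ.ne' h hXY)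

lemma ConformalOn.symplecticallyEmbeds {n : ℕ} {F : Cn n → Cn n} (hF : ConformalOn 1 F Set.univ)
    {X Y : Set (Cn n)} (hXY : Set.MapsTo F X Y) : SymplecticallyEmbeds X Y := by
  refine ⟨Set.univ, F, isOpen_univ, Set.subset_univ _,
    fun x hx => (hF.contDiffAt x hx).contDiffWithinAt, hF.injOn, fun x hx => ?_, hXY⟩
  obtain ⟨F', hF', hF2⟩ := hF.pullback x hx
  rw [hF'.fderiv]
  ext v
  simpa [stdForm_apply] using hF2 (v 0) (v 1)

lemma mem_ball_iff {n : ℕ} {r : ℝ} {z : Cn n} : z ∈ ball n r ↔ ∑ k, Real.pi * ‖z k‖ ^ 2 < r :=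
  and_iff_right fun k => mul_nonneg Real.pi_pos.le (sq_nonneg ‖z k‖)

lemma mem_cylinder_iff {n : ℕ} [NeZero n] {r : ℝ} {z : Cn n} :
    z ∈ cylinder n r ↔ Real.pi * ‖z ⊤‖ ^ 2 < r :=
  and_iff_right fun k => mul_nonneg Real.pi_pos.le (sq_nonneg ‖z k‖)

lemma smul_mem_ball_iff {n : ℕ} {r t : ℝ} (ht : 0 < t) {z : Cn n} :
    t • z ∈ ball n (t ^ 2 * r) ↔ z ∈ ball n r := by
  have : ∑ k, Real.pi * ‖(t • z) k‖ ^ 2 = t ^ 2 * ∑ k, Real.pi * ‖z k‖ ^ 2 := by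
    rw [Finset.mul_sum]
    refine Finset.sum_congr rfl fun k _ => ?_
    rw [Pi.smul_apply, norm_smul, mul_pow, Real.norm_eq_abs, sq_abs]
    ring
  rw [mem_ball_iff, mem_ball_iff, this, mul_lt_mul_iff_right₀ (by positivity)]

lemma smul_mem_cylinder_iff {n : ℕ} [NeZero n] {r t : ℝ} (ht : 0 < t) {z : Cn n} :
    t • z ∈ cylinder n (t ^ 2 * r) ↔ z ∈ cylinder n r := by
  have : Real.pi * ‖(t • z) ⊤‖ ^ 2 = t ^ 2 * (Real.pi * ‖z ⊤‖ ^ 2) := by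
    rw [Pi.smul_apply, norm_smul, mul_pow, Real.norm_eq_abs, sq_abs]
    ring
  rw [mem_cylinder_iff, mem_cylinder_iff, this, mul_lt_mul_iff_right₀ (by positivity)]

lemma dilate_eq_of_smul_mem_iff {n : ℕ} {t : ℝ} (ht : 0 < t) {X Y : Set (Cn n)}
    (h : ∀ z, t • z ∈ Y ↔ z ∈ X) : dilate t X = Y := by
  ext w
  constructor
  · rintro ⟨z, hz, rfl⟩
    exact (h z).2 hz
  · intro hw
    have : t • t⁻¹ • w = w := smul_inv_smul₀ ht.ne' w
    exact ⟨t⁻¹ • w, (h _).1 (this.symm ▸ hw), this⟩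

/-! ### The value of a normalized capacity -/

/-- The bounds that every normalized capacity satisfies on `X_Ω`: the simplices contained in `Ω`
bound its value from below, the points outside `Ω` bound it from above. -/
structure IsPinned {n : ℕ} (Ω : Set (Fin n → ℝ)) (v : ℝ≥0∞) : Prop where
  lower : ∀ r R : ℝ, 0 < r → r < R → (∀ x, (∀ k, 0 < x k) → ∑ k, x k < R → x ∈ Ω) →
    ENNReal.ofReal r ≤ v
  upper : ∀ (R : ℝ) (x : Fin n → ℝ), (∀ k, 0 < x k) → ∑ k, x k < R → x ∉ Ω → v ≤ ENNReal.ofReal R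

/-- If `w < r < R < v`, then either the simplex of size `R` lies in `Ω`, which gives `r ≤ w`, or it
misses a point, which gives `v ≤ R`; both are absurd. -/
lemma IsPinned.le {n : ℕ} {Ω : Set (Fin n → ℝ)} {v w : ℝ≥0∞} (hv : IsPinned Ω v)
    (hw : IsPinned Ω w) : v ≤ w := by
  by_contra! h
  obtain ⟨r, hwr, hr⟩ := ENNReal.lt_iff_exists_nnreal_btwn.1 h
  obtain ⟨R, hrR, hRv⟩ := ENNReal.lt_iff_exists_nnreal_btwn.1 hr
  have hr0 : 0 < r := by
    have := (zero_le (a := w)).trans_lt hwr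
    exact_mod_cast this
  have hrR' : (r : ℝ) < R := by exact_mod_cast hrR
  by_cases hs : ∀ x, (∀ k, 0 < x k) → ∑ k, x k < (R : ℝ) → x ∈ Ω
  · have := hw.lower r R hr0 hrR' hs
    rw [ENNReal.ofReal_coe_nnreal] at this
    exact absurd this (not_le.2 hwr)
  · push Not at hs
    obtain ⟨x, hx, hxR, hxΩ⟩ := hs
    have := hv.upper R x hx hxR hxΩ
    rw [ENNReal.ofReal_coe_nnreal] at this
    exact absurd this (not_le.2 hRv)

lemma exists_map_from_ball {n : ℕ} [NeZero n] {Ω : Set (Fin n → ℝ)} {r R : ℝ} (h : r < R)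
    (hΩ : ∀ x, (∀ k, 0 < x k) → ∑ k, x k < R → x ∈ Ω) :
    ∃ F : Cn n → Cn n, ConformalOn 1 F Set.univ ∧ Set.MapsTo F (ball n r) (toricDomain Ω) := by
  obtain ⟨F, hF, hF2⟩ := exists_embedding_of_ball (n := n) h
  exact ⟨F, hF, fun z hz => hΩ _ (hF2 z hz).1 (hF2 z hz).2⟩

/-- A point of `X_Ω` with `π|zₖ|² > xₖ` for all `k` would force `x ∈ Ω` by `IsMonotone.mem_of_lt`;
hence `X_Ω` lies in the union of the cylinders over discs of area `xₖ`. -/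
lemma IsMonotone.exists_map_to_cylinder {n : ℕ} [NeZero n] {Ω : Set (Fin n → ℝ)}
    (hΩ : IsMonotone Ω) {R : ℝ} {x : Fin n → ℝ} (hx : ∀ k, 0 < x k) (hxR : ∑ k, x k < R)
    (hxΩ : x ∉ Ω) :
    ∃ F : Cn n → Cn n, ConformalOn 1 F Set.univ ∧
      Set.MapsTo F (toricDomain Ω) (cylinder n R) := by
  obtain ⟨F, hF, hF2⟩ := exists_embedding_into_cylinder hx hxR
  refine ⟨F, hF, fun z hz => mem_cylinder_iff.2 (hF2 z ?_)⟩
  by_contra! h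
  exact hxΩ (hΩ.mem_of_lt hx h hz)

lemma pos_of_sum_lt {n : ℕ} {x : Fin n → ℝ} {R : ℝ} (hx : ∀ k, 0 < x k) (hxR : ∑ k, x k < R) :
    0 < R := (Finset.sum_nonneg fun k _ => (hx k).le).trans_lt hxR

lemma Capacity.IsNormalized.isPinned {n : ℕ} [NeZero n] {c : Capacity n} (hc : c.IsNormalized)
    {Ω : Set (Fin n → ℝ)} (hΩ : IsMonotone Ω) (hX : IsOpen (toricDomain Ω))
    (hdom : ofOpens n ⟨toricDomain Ω, hX⟩ ∈ c.dom) :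
    IsPinned Ω (c.val (ofOpens n ⟨toricDomain Ω, hX⟩)) where
  lower r R hr hrR h := by
    obtain ⟨F, hF, hF2⟩ := exists_map_from_ball hrR h
    have hs : 0 < √r := Real.sqrt_pos.2 hr
    have hss : √r ^ 2 = r := Real.sq_sqrt hr.le
    -- Dilating by `√r` first makes this an embedding of `(B(1), rω)` into `(X_Ω, ω)`.
    have hG := hF.comp (conformalOn_smul n hs.ne') (Set.mapsTo_univ _ _)
    rw [hss, one_mul] at hG
    have := c.mul_le_mul hr one_pos hr.ne' hG (one_mul r)
      (X := ⟨ball n 1, isOpen_ball n 1⟩) (Y := ⟨toricDomain Ω, hX⟩) (fun z hz => hF2 ?_)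
      hc.ball_mem hdom
    · simpa [hc.val_ball] using this
    · have := (smul_mem_ball_iff (r := 1) hs).2 hz
      rwa [hss, mul_one] at this
  upper R x hx hxR hxΩ := by
    obtain ⟨F, hF, hF2⟩ := hΩ.exists_map_to_cylinder hx hxR hxΩ
    have hR : 0 < R := pos_of_sum_lt hx hxR
    have hs : 0 < √R := Real.sqrt_pos.2 hR
    have hss : √R ^ 2 = R := Real.sq_sqrt hR.le
    -- Dilating by `1/√R` afterwards makes this an embedding of `(X_Ω, ω)` into `(Z(1), Rω)`.
    have hG := (conformalOn_smul n (inv_ne_zero hs.ne')).comp hF (Set.mapsTo_univ _ _)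
    rw [inv_pow, hss, mul_one] at hG
    have := c.mul_le_mul one_pos hR (inv_ne_zero hR.ne') hG (mul_inv_cancel₀ hR.ne')
      (X := ⟨toricDomain Ω, hX⟩) (Y := ⟨cylinder n 1, isOpen_cylinder n 1⟩) (fun z hz => ?_)
      hdom hc.cylinder_mem
    · simpa [hc.val_cylinder] using this
    · refine (smul_mem_cylinder_iff (r := 1) hs).1 ?_
      rw [hss, mul_one, Function.comp_apply, smul_inv_smul₀ hs.ne']
      exact hF2 hz

lemma SubsetCapacity.IsNormalized.isPinned {n : ℕ} [NeZero n] {c : SubsetCapacity n}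
    (hc : c.IsNormalized) {Ω : Set (Fin n → ℝ)} (hΩ : IsMonotone Ω)
    (hdom : toricDomain Ω ∈ c.dom) : IsPinned Ω (c.val (toricDomain Ω)) where
  lower r R hr hrR h := by
    obtain ⟨F, hF, hF2⟩ := exists_map_from_ball hrR h
    have hs : 0 < √r := Real.sqrt_pos.2 hr
    have hss : √r ^ 2 = r := Real.sq_sqrt hr.le
    have hd : dilate (√r) (ball n 1) = ball n r := by
      refine dilate_eq_of_smul_mem_iff hs fun z => ?_
      have := smul_mem_ball_iff (r := 1) hs (z := z)
      rwa [hss, mul_one] at this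
    have hv := c.conformal _ hc.ball_mem _ hs
    rw [hd, hc.val_ball, hss, mul_one] at hv
    rw [← hv]
    exact c.monotone _ (hd ▸ c.dilate_mem _ hc.ball_mem _ hs) _ hdom
      (hF.symplecticallyEmbeds hF2)
  upper R x hx hxR hxΩ := by
    obtain ⟨F, hF, hF2⟩ := hΩ.exists_map_to_cylinder hx hxR hxΩ
    have hR : 0 < R := pos_of_sum_lt hx hxR
    have hs : 0 < √R := Real.sqrt_pos.2 hR
    have hss : √R ^ 2 = R := Real.sq_sqrt hR.le
    have hd : dilate (√R) (cylinder n 1) = cylinder n R := by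
      refine dilate_eq_of_smul_mem_iff hs fun z => ?_
      have := smul_mem_cylinder_iff (r := 1) hs (z := z)
      rwa [hss, mul_one] at this
    have hv := c.conformal _ hc.cylinder_mem _ hs
    rw [hd, hc.val_cylinder, hss, mul_one] at hv
    rw [← hv]
    exact c.monotone _ hdom _ (hd ▸ c.dilate_mem _ hc.cylinder_mem _ hs)
      (hF.symplecticallyEmbeds hF2)

end SymplecticCapacities

end

/-- All normalized symplectic capacities agree on monotone toric domains, both for capacities of
symplectic manifolds (where the toric domain has to be open) and for capacities of subsets of `ℂⁿ`
(where it may be open, closed, or neither). -/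
theorem theorem1p2 (n : ℕ) [NeZero n] (Ω : Set (Fin n → ℝ))
    (hΩ : SymplecticCapacities.IsMonotone Ω) :
    (∀ hX : IsOpen (SymplecticCapacities.toricDomain Ω),
      ∀ c₁ c₂ : SymplecticCapacities.Capacity n, c₁.IsNormalized → c₂.IsNormalized →
        SymplecticCapacities.ofOpens n ⟨SymplecticCapacities.toricDomain Ω, hX⟩ ∈ c₁.dom →
        SymplecticCapacities.ofOpens n ⟨SymplecticCapacities.toricDomain Ω, hX⟩ ∈ c₂.dom →
        c₁.val (SymplecticCapacities.ofOpens n ⟨SymplecticCapacities.toricDomain Ω, hX⟩) =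
          c₂.val (SymplecticCapacities.ofOpens n ⟨SymplecticCapacities.toricDomain Ω, hX⟩)) ∧
    (∀ c₁ c₂ : SymplecticCapacities.SubsetCapacity n, c₁.IsNormalized → c₂.IsNormalized →
      SymplecticCapacities.toricDomain Ω ∈ c₁.dom →
      SymplecticCapacities.toricDomain Ω ∈ c₂.dom →
      c₁.val (SymplecticCapacities.toricDomain Ω) =
        c₂.val (SymplecticCapacities.toricDomain Ω)) := by
  exact ⟨fun hX c₁ c₂ h₁ h₂ hd₁ hd₂ =>
      ((h₁.isPinned hΩ hX hd₁).le (h₂.isPinned hΩ hX hd₂)).antisymm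
        ((h₂.isPinned hΩ hX hd₂).le (h₁.isPinned hΩ hX hd₁)),
    fun c₁ c₂ h₁ h₂ hd₁ hd₂ =>
      ((h₁.isPinned hΩ hd₁).le (h₂.isPinned hΩ hd₂)).antisymm
        ((h₂.isPinned hΩ hd₂).le (h₁.isPinned hΩ hd₁))⟩
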